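/- Let $n\ge 2$ and let $H^n=\{(x',x_n): x'\in\mathbf R^{n-1},\ x_n>0\}$ carry the hyperbolic metric $ds^2=(dx_1^2+\cdots+dx_n^2)/x_n^2$, with Riemannian distance $d$ and origin $o=(0,1)$. The horocycles in $H^n$ are the planes $x_n=c$ $(c>0)$ and the Euclidean $(n-1)$-spheres in $x_n\ge 0$ tangent to the boundary $x_n=0$ (with the point of tangency removed). A point of $H^n$ is said to be outside the plane $x_n=c$ if $x_n<c$, and outside a tangent sphere if it lies outside that sphere in the Euclidean sense; a horocycle $\xi$ lies outside a horocycle $\xi_0$ if every point of $\xi$ is outside $\xi_0$. For a function $f$ on $H^n$ the horocycle transform is $\widehat f(\xi)=\int_\xi f\,dm$, where $dm$ is the Riemannian volume measure on the hypersurface $\xi$ induced by $ds^2$. Theorem 2.2. Let $\xi_0\subset H^n$ be a fixed horocycle. Let $f:H^n\to\mathbf C$ be continuous and exponentially decreasing, i.e. $\sup_{x\in H^n}|f(x)|\,e^{m\,d(o,x)}<\infty$ for each $m>0$. If $\widehat f(\xi)=0$ for every horocycle $\xi$ lying outside $\xi_0$, then $f(x)=0$ for all $x$ outside $\xi_0$.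 -/

import Mathlib

noncomputable section

/-- The coordinate space `ℝⁿ = ℝⁿ⁻¹ × ℝ`, a point being written `(x', xₙ)`. It is used for `n ≥ 2`.
Only the topology and the smooth structure of the product are used; the Euclidean inner product
appears explicitly in `hypMetric`. -/
abbrev CoordSpace (n : ℕ) : Type := EuclideanSpace ℝ (Fin (n - 1)) × ℝ

/-- Hyperbolic space `Hⁿ` in the half-space model: points `(x', xₙ)` with `xₙ > 0`. -/
abbrev HalfSpace (n : ℕ) : Type := {x : CoordSpace n // 0 < x.2}

/-- The Riemannian metric `ds² = (dx₁² + ⋯ + dxₙ²) / xₙ²`, at `x` on tangent vectors `v`, `w`. -/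
def hypMetric {n : ℕ} (x v w : CoordSpace n) : ℝ :=
  (inner ℝ v.1 w.1 + v.2 * w.2) / x.2 ^ 2

/-- The hyperbolic length of a curve `γ` over the parameter interval `[0, 1]`. -/
def hypLength {n : ℕ} (γ : ℝ → CoordSpace n) : ℝ :=
  ∫ t in (0 : ℝ)..1, √(hypMetric (γ t) (deriv γ t) (deriv γ t))

/-- The Riemannian distance: the infimum of the lengths of the `C¹` curves in the half space that
join the two points. -/
def hypDist {n : ℕ} (x y : HalfSpace n) : ℝ :=
  sInf {L : ℝ | ∃ γ : ℝ → CoordSpace n, ContDiff ℝ 1 γ ∧ (∀ t ∈ Set.Icc (0 : ℝ) 1, 0 < (γ t).2) ∧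
    γ 0 = x.1 ∧ γ 1 = y.1 ∧ L = hypLength γ}

/-- The origin `(0, 1)` of `Hⁿ`. -/
def hypOrigin (n : ℕ) : HalfSpace n := ⟨(0, 1), one_pos⟩

/-- `f` is exponentially decreasing: `sup_x |f x| e^{m d(o, x)} < ∞` for each `m > 0`. -/
def ExponentiallyDecreasing {n : ℕ} (f : HalfSpace n → ℂ) : Prop :=
  ∀ m : ℝ, 0 < m →
    BddAbove (Set.range fun x : HalfSpace n => ‖f x‖ * Real.exp (m * hypDist (hypOrigin n) x))

/-- The horocycles of `Hⁿ`: the planes `xₙ = c` with `c > 0`, and the Euclidean spheres with center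
`(a, r)` and radius `r > 0`, which are those tangent to the boundary `xₙ = 0` (at `(a, 0)`). -/
inductive Horocycle (n : ℕ) : Type
  | plane (c : ℝ) (hc : 0 < c) : Horocycle n
  | sphere (a : EuclideanSpace ℝ (Fin (n - 1))) (r : ℝ) (hr : 0 < r) : Horocycle n

namespace Horocycle

/-- The set of points of `Hⁿ` on the horocycle (the point of tangency is not in `Hⁿ`). -/
def carrier {n : ℕ} : Horocycle n → Set (HalfSpace n)
  | plane c _ => {x | x.1.2 = c}
  | sphere a r _ => {x | ‖x.1.1 - a‖ ^ 2 + (x.1.2 - r) ^ 2 = r ^ 2}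

/-- The points of `Hⁿ` outside the horocycle, i.e. the complement of the closed horoball: the region
below the plane, or the region outside the Euclidean sphere. -/
def exterior {n : ℕ} : Horocycle n → Set (HalfSpace n)
  | plane c _ => {x | x.1.2 < c}
  | sphere a r _ => {x | r ^ 2 < ‖x.1.1 - a‖ ^ 2 + (x.1.2 - r) ^ 2}

/-- A global chart of the horocycle: the obvious one for a plane, and for a sphere the stereographic
projection from the point of tangency. -/
def param {n : ℕ} : Horocycle n → EuclideanSpace ℝ (Fin (n - 1)) → HalfSpace n
  | plane c hc, y => ⟨(y, c), hc⟩
  | sphere a r hr, y =>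
      ⟨(a + (2 * r / (1 + ‖y‖ ^ 2)) • y, 2 * r / (1 + ‖y‖ ^ 2)), by positivity⟩

theorem param_injective {n : ℕ} (ξ : Horocycle n) : Function.Injective ξ.param := by
  cases ξ with
  | plane c hc =>
    intro y z h
    exact congrArg (fun p : HalfSpace n => p.1.1) h
  | sphere a r hr =>
    intro y z h
    have h1 := congrArg (fun p : HalfSpace n => p.1.1) h
    have h2 := congrArg (fun p : HalfSpace n => p.1.2) h
    simp only [param] at h1 h2
    rw [h2] at h1
    have hpos : 2 * r / (1 + ‖z‖ ^ 2) ≠ 0 := by positivity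
    exact smul_right_injective _ hpos (add_left_cancel h1)

theorem range_param {n : ℕ} (ξ : Horocycle n) : Set.range ξ.param = ξ.carrier := by
  cases ξ with
  | plane c hc =>
    ext x
    constructor
    · rintro ⟨y, rfl⟩
      rfl
    · intro hx
      exact ⟨x.1.1, Subtype.ext (Prod.ext rfl (Eq.symm hx))⟩
  | sphere a r hr =>
    ext x
    constructor
    · rintro ⟨y, rfl⟩
      have h : (1 + ‖y‖ ^ 2) ≠ 0 := by positivity
      simp only [param, carrier, Set.mem_ofPred_eq, add_sub_cancel_left, norm_smul, mul_pow,
        Real.norm_eq_abs, sq_abs]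
      field_simp
      ring
    · intro hx
      have hx' : ‖x.1.1 - a‖ ^ 2 + (x.1.2 - r) ^ 2 = r ^ 2 := hx
      have hpos := x.2
      have hn : ‖x.1.2⁻¹ • (x.1.1 - a)‖ ^ 2 = (x.1.2 ^ 2)⁻¹ * ‖x.1.1 - a‖ ^ 2 := by
        rw [norm_smul, mul_pow, Real.norm_eq_abs, sq_abs, inv_pow]
      have key : 2 * r / (1 + ‖x.1.2⁻¹ • (x.1.1 - a)‖ ^ 2) = x.1.2 := by
        have e : ‖x.1.1 - a‖ ^ 2 = 2 * r * x.1.2 - x.1.2 ^ 2 := by linarith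
        rw [hn, e]
        have e2 : 1 + (x.1.2 ^ 2)⁻¹ * (2 * r * x.1.2 - x.1.2 ^ 2) = 2 * r / x.1.2 := by
          field_simp
          ring
        rw [e2]
        field_simp
      refine ⟨x.1.2⁻¹ • (x.1.1 - a), Subtype.ext (Prod.ext ?_ key)⟩
      simp only [param]
      rw [key, smul_smul, mul_inv_cancel₀ hpos.ne', one_smul, add_sub_cancel]

/-- The density, in the chart, of the Riemannian volume of the metric that `hypMetric` induces on the
horocycle: the square root of the Gram determinant of the coordinate tangent vectors. -/
def volumeDensity {n : ℕ} (ξ : Horocycle n) (y : EuclideanSpace ℝ (Fin (n - 1))) : ℝ :=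
  √(Matrix.det (Matrix.of fun i j : Fin (n - 1) =>
    hypMetric (ξ.param y).1
      (fderiv ℝ (fun z => (ξ.param z).1) y (EuclideanSpace.single i 1))
      (fderiv ℝ (fun z => (ξ.param z).1) y (EuclideanSpace.single j 1))))

end Horocycle

/-- The horocycle transform: the integral of `f` over `ξ` with respect to the Riemannian volume that
`ξ` carries as a hypersurface of `Hⁿ`, computed in the global chart. -/
def horocycleTransform {n : ℕ} (f : HalfSpace n → ℂ) (ξ : Horocycle n) : ℂ :=
  ∫ y : EuclideanSpace ℝ (Fin (n - 1)), (ξ.volumeDensity y : ℂ) * f (ξ.param y)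

end

open MeasureTheory Set Filter Topology Metric
open scoped FourierTransform

noncomputable section

/-! An inversion centred at the point of tangency turns a spherical `ξ₀` into a horizontal plane, so
it suffices to show that `f` vanishes below height `c` when its integrals over the tangent spheres
below that height vanish. Spheres tangent at the centre of inversion would become planes; their
points of tangency form a null set and are ignored.

In the stereographic chart, the sphere of diameter `R` tangent at `b` is `y ↦ (b + t y, t)` with `t
= R / (1 + ‖y‖²)`, and its induced metric is flat (`volumeDensity_sphere`). A Fourier transform in
`b` turns the shift `t y` into a phase and separates frequencies: if `φ t` is the transform at `η`
of the slice at height `t`, then `∫ cos (t ⟪y, 2πη⟫) φ t dy = 0`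
(`integral_char_smul_fourier_slice`, `integral_cos_smul_eq_zero`). In polar coordinates with `s =
‖y‖` one has `(t s)² = t (R - t)`, and for `d = n - 1` this becomes `∫₀ᴿ (R - t)^(d/2 - 1) K(t (R -
t)) u(t) dt = 0`, `u(t) = t^(-d/2 - 1) φ t`, where `K` is entire and `K(0)` is the area of the unit
sphere (`integral_cos_smul_horosphere_height`).

This is a Volterra equation of the first kind with an Abel singularity
(`eqOn_zero_of_abel_volterra`). Since `K - K(0)` is itself an Abel transform (`exists_abel_kernel`),
the left side is the fractional integral of order `d/2` of `K(0) u` plus a Volterra integral of `u`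
with continuous kernel. Fractional integration is injective, because applying it twice gives the
integer order `d`; Grönwall's lemma then gives `u = 0`, and Fourier inversion gives `f = 0`.

Exponential decrease bounds `f` by any power of `t / (1 + ‖x'‖)`. This justifies Fubini and Fourier
inversion and makes `u` continuous at `0`. -/

/-! ### Abel kernels and fractional integrals -/

theorem integrableOn_sub_rpow {a : ℝ} (ha : 0 < a) (t S : ℝ) :
    IntegrableOn (fun x : ℝ => (S - x) ^ (a - 1)) (Ioo t S) := by
  rcases le_or_gt S t with h | h
  · simp [Ioo_eq_empty (not_lt.2 h)]
  · have h1 : IntervalIntegrable (fun x : ℝ => x ^ (a - 1)) volume (S - t) (S - S) :=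
      intervalIntegral.intervalIntegrable_rpow' (by linarith)
    have h2 := (h1.comp_sub_left S)
    simp only [sub_sub_cancel] at h2
    exact ((intervalIntegrable_iff_integrableOn_Ioc_of_le h.le).1 h2).mono_set Ioo_subset_Ioc_self

theorem setIntegral_sub_rpow {b : ℝ} (hb : 0 < b) {R : ℝ} (hR : 0 ≤ R) :
    ∫ t in Ioo 0 R, (R - t) ^ (b - 1) = R ^ b / b := by
  rw [← integral_Ioc_eq_integral_Ioo, ← intervalIntegral.integral_of_le hR,
    intervalIntegral.integral_comp_sub_left (fun x : ℝ => x ^ (b - 1)),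
    integral_rpow (Or.inl (by linarith))]
  simp [Real.zero_rpow hb.ne']

/-- The kernel `(S - R) ^ (a - 1) * (R - t) ^ (b - 1)` is integrable over `0 < t < R < S`. -/
theorem integrable_abel_kernel {a b : ℝ} (ha : 0 < a) (hb : 0 < b) {S : ℝ} :
    Integrable (fun p : ℝ × ℝ =>
      {p : ℝ × ℝ | 0 < p.2 ∧ p.2 < p.1 ∧ p.1 < S}.indicator
        (fun p => (S - p.1) ^ (a - 1) * (p.1 - p.2) ^ (b - 1)) p) := by
  set D : Set (ℝ × ℝ) := {p : ℝ × ℝ | 0 < p.2 ∧ p.2 < p.1 ∧ p.1 < S} with hD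
  have hDm : MeasurableSet D :=
    (measurableSet_lt measurable_const measurable_snd).inter
      ((measurableSet_lt measurable_snd measurable_fst).inter
        (measurableSet_lt measurable_fst measurable_const))
  have hslice : ∀ R t : ℝ, D.indicator (fun p : ℝ × ℝ =>
      (S - p.1) ^ (a - 1) * (p.1 - p.2) ^ (b - 1)) (R, t) =
      (Ioo 0 S).indicator (fun R => (S - R) ^ (a - 1)) R *
        (Ioo 0 R).indicator (fun t => (R - t) ^ (b - 1)) t := by
    intro R t
    by_cases h1 : t ∈ Ioo 0 R
    · by_cases h2 : R < S
      · have h3 : (R, t) ∈ D := ⟨h1.1, h1.2, h2⟩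
        have h4 : R ∈ Ioo 0 S := ⟨h1.1.trans h1.2, h2⟩
        simp only [indicator_of_mem h1, indicator_of_mem h3, indicator_of_mem h4]
      · have h3 : (R, t) ∉ D := fun h => h2 h.2.2
        have h4 : R ∉ Ioo 0 S := fun h => h2 h.2
        simp only [indicator_of_notMem h3, indicator_of_notMem h4, zero_mul]
    · have h3 : (R, t) ∉ D := fun h => h1 ⟨h.1, h.2.1⟩
      simp only [indicator_of_notMem h3, indicator_of_notMem h1, mul_zero]
  have hmeas : AEStronglyMeasurable (fun p : ℝ × ℝ => D.indicator (fun p : ℝ × ℝ =>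
      (S - p.1) ^ (a - 1) * (p.1 - p.2) ^ (b - 1)) p) (volume.prod volume) := by
    apply Measurable.aestronglyMeasurable
    apply Measurable.indicator _ hDm
    fun_prop
  rw [Measure.volume_eq_prod, integrable_prod_iff hmeas]
  simp only [hslice, norm_mul, integral_const_mul]
  constructor
  · refine Eventually.of_forall fun R => Integrable.const_mul ?_ _
    exact (integrable_indicator_iff measurableSet_Ioo).2 (integrableOn_sub_rpow hb 0 R)
  · have hN : ∀ R : ℝ, 0 ≤ R →
        ∫ t, ‖(Ioo 0 R).indicator (fun t => (R - t) ^ (b - 1)) t‖ = R ^ b / b := by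
      intro R hR
      rw [← setIntegral_sub_rpow hb hR, ← integral_indicator measurableSet_Ioo]
      congr 1
      ext t
      rw [norm_indicator_eq_indicator_norm]
      refine congrFun (indicator_congr fun t ht => ?_) t
      exact Real.norm_of_nonneg (Real.rpow_nonneg (by linarith [ht.2]) _)
    have h1 : Integrable ((Ioo 0 S).indicator
        (fun R => ‖(S - R) ^ (a - 1)‖ * (R ^ b / b))) := by
      rw [integrable_indicator_iff measurableSet_Ioo]
      have h0 := (integrableOn_sub_rpow ha 0 S).norm
      refine Integrable.mul_bdd (c := S ^ b / b) h0 ?_ ?_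
      · exact Measurable.aestronglyMeasurable (by fun_prop)
      · refine (ae_restrict_mem measurableSet_Ioo).mono fun R hR => ?_
        have hR0 := hR.1.le
        rw [Real.norm_of_nonneg (by positivity)]
        gcongr
        exact hR.2.le
    convert h1 using 2 with R
    by_cases hR : R ∈ Ioo 0 S
    · simp only [indicator_of_mem hR, hN R hR.1.le]
    · simp only [indicator_of_notMem hR, norm_zero, zero_mul]

/-- Fubini's theorem on the triangle `0 < t < R < S` with Abel weights. -/
theorem abel_fubini {a b : ℝ} (ha : 0 < a) (hb : 0 < b) {S : ℝ} {F : ℝ × ℝ → ℂ}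
    (hF : Continuous F) :
    ∫ R in Ioo 0 S, ∫ t in Ioo 0 R, ((S - R) ^ (a - 1) * (R - t) ^ (b - 1)) • F (R, t) =
    ∫ t in Ioo 0 S, ∫ R in Ioo t S, ((S - R) ^ (a - 1) * (R - t) ^ (b - 1)) • F (R, t) := by
  set D : Set (ℝ × ℝ) := {p : ℝ × ℝ | 0 < p.2 ∧ p.2 < p.1 ∧ p.1 < S} with hD
  have hDm : MeasurableSet D :=
    (measurableSet_lt measurable_const measurable_snd).inter
      ((measurableSet_lt measurable_snd measurable_fst).inter
        (measurableSet_lt measurable_fst measurable_const))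
  set k : ℝ × ℝ → ℝ := fun p => (S - p.1) ^ (a - 1) * (p.1 - p.2) ^ (b - 1) with hk
  have hint : Integrable (D.indicator (fun p => k p • F p)) (volume.prod volume) := by
    obtain ⟨A, hA⟩ := (isCompact_Icc (a := (0 : ℝ)) (b := S)).prod
      (isCompact_Icc (a := (0 : ℝ)) (b := S)) |>.exists_bound_of_continuousOn hF.continuousOn
    have hkm : Measurable k := by fun_prop
    refine Integrable.mono' (g := fun p => D.indicator k p * A)
      ((integrable_abel_kernel ha hb).mul_const A) ?_ ?_
    · exact ((hkm.smul hF.measurable).indicator hDm).aestronglyMeasurable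
    · refine Eventually.of_forall fun p => ?_
      by_cases hp : p ∈ D
      · simp only [indicator_of_mem hp, norm_smul]
        obtain ⟨h1, h2, h3⟩ := hp
        have hk0 : 0 ≤ k p := mul_nonneg (Real.rpow_nonneg (by linarith) _)
          (Real.rpow_nonneg (by linarith) _)
        rw [Real.norm_of_nonneg hk0]
        exact mul_le_mul_of_nonneg_left
          (hA p ⟨⟨by linarith, by linarith⟩, ⟨by linarith, by linarith⟩⟩) hk0
      · simp only [indicator_of_notMem hp, norm_zero, zero_mul, le_refl]
  have hswap := integral_integral_swap (f := fun R t => D.indicator (fun p => k p • F p) (R, t))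
    hint
  rw [← integral_indicator measurableSet_Ioo, ← integral_indicator measurableSet_Ioo]
  refine (integral_congr_ae (Eventually.of_forall fun R => ?_)).trans
    (hswap.trans (integral_congr_ae (Eventually.of_forall fun t => ?_)))
  · by_cases hR : R ∈ Ioo 0 S
    · rw [indicator_of_mem hR, ← integral_indicator measurableSet_Ioo]
      refine integral_congr_ae (Eventually.of_forall fun t => ?_)
      beta_reduce
      by_cases ht : t ∈ Ioo 0 R
      · rw [indicator_of_mem ht, indicator_of_mem (show (R, t) ∈ D from ⟨ht.1, ht.2, hR.2⟩)]
      · rw [indicator_of_notMem ht,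
          indicator_of_notMem (show (R, t) ∉ D from fun h => ht ⟨h.1, h.2.1⟩)]
    · rw [indicator_of_notMem hR, integral_eq_zero_of_ae]
      refine Eventually.of_forall fun t => ?_
      exact indicator_of_notMem (fun h => hR ⟨h.1.trans h.2.1, h.2.2⟩) _
  · beta_reduce
    by_cases ht : t ∈ Ioo 0 S
    · rw [indicator_of_mem ht, ← integral_indicator measurableSet_Ioo]
      refine integral_congr_ae (Eventually.of_forall fun R => ?_)
      beta_reduce
      by_cases hR : R ∈ Ioo t S
      · rw [indicator_of_mem hR, indicator_of_mem (show (R, t) ∈ D from ⟨ht.1, hR.1, hR.2⟩)]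
      · rw [indicator_of_notMem hR,
          indicator_of_notMem (show (R, t) ∉ D from fun h => hR ⟨h.2.1, h.2.2⟩)]
    · rw [indicator_of_notMem ht, integral_eq_zero_of_ae]
      refine Eventually.of_forall fun R => ?_
      exact indicator_of_notMem (fun h : (R, t) ∈ D => ht ⟨h.1, h.2.1.trans h.2.2⟩) _

theorem setIntegral_Ioo_eq_unit (f : ℝ → ℂ) {t S : ℝ} (h : t < S) :
    ∫ R in Ioo t S, f R = (S - t) • ∫ v in Ioo (0 : ℝ) 1, f (t + (S - t) * v) := by
  rw [← integral_Ioc_eq_integral_Ioo, ← integral_Ioc_eq_integral_Ioo,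
    ← intervalIntegral.integral_of_le h.le, ← intervalIntegral.integral_of_le zero_le_one,
    intervalIntegral.integral_comp_add_mul f (sub_pos.2 h).ne']
  rw [smul_smul, mul_inv_cancel₀ (sub_pos.2 h).ne']
  simp

/-- The Beta integral. -/
def betaInt (a b : ℝ) : ℝ := ∫ v in Ioo (0 : ℝ) 1, (1 - v) ^ (a - 1) * v ^ (b - 1)

theorem integrableOn_beta {a b : ℝ} (ha : 0 < a) (hb : 0 < b) :
    IntegrableOn (fun v : ℝ => (1 - v) ^ (a - 1) * v ^ (b - 1)) (Ioo 0 1) := by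
  have h := Complex.betaIntegral_convergent (u := b) (v := a) (by simpa) (by simpa)
  have h2 := ((intervalIntegrable_iff_integrableOn_Ioc_of_le zero_le_one).1 h).mono_set
    Ioo_subset_Ioc_self |>.norm
  refine IntegrableOn.congr_fun h2 (fun v hv => ?_) measurableSet_Ioo
  have h1 : (1 - (v : ℂ)) = ((1 - v : ℝ) : ℂ) := by push_cast; ring
  simp only [norm_mul, h1]
  rw [Complex.norm_cpow_eq_rpow_re_of_pos hv.1,
    Complex.norm_cpow_eq_rpow_re_of_pos (by linarith [hv.2] : 0 < 1 - v), mul_comm]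
  simp

theorem betaInt_pos {a b : ℝ} (ha : 0 < a) (hb : 0 < b) : 0 < betaInt a b := by
  refine (setIntegral_pos_iff_support_of_nonneg_ae ?_ (integrableOn_beta ha hb)).2 ?_
  · refine (ae_restrict_mem measurableSet_Ioo).mono fun v hv => ?_
    exact mul_nonneg (Real.rpow_nonneg (by linarith [hv.2]) _) (Real.rpow_nonneg hv.1.le _)
  · refine lt_of_lt_of_le (b := volume (Ioo (0 : ℝ) 1)) (by simp) (measure_mono fun v hv => ?_)
    refine ⟨ne_of_gt ?_, hv⟩
    exact mul_pos (Real.rpow_pos_of_pos (by linarith [hv.2]) _) (Real.rpow_pos_of_pos hv.1 _)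

/-- The Riemann–Liouville integral of order `a`, without the factor `1 / Γ a`. -/
def fracInt (a : ℝ) (u : ℝ → ℂ) (S : ℝ) : ℂ := ∫ t in Ioo 0 S, ((S - t) ^ (a - 1)) • u t

/-- The semigroup law: after exchanging the integrals, the inner one is a Beta integral via `R = t +
(S - t) v`. -/
theorem fracInt_fracInt {a b : ℝ} (ha : 0 < a) (hb : 0 < b) {u : ℝ → ℂ} (hu : Continuous u)
    (S : ℝ) : fracInt a (fracInt b u) S = betaInt a b • fracInt (a + b) u S := by
  have h := abel_fubini ha hb (S := S) (F := fun p => u p.2) (by fun_prop)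
  simp only [fracInt]
  have h1 : ∀ R : ℝ, (S - R) ^ (a - 1) • ∫ t in Ioo 0 R, (R - t) ^ (b - 1) • u t =
      ∫ t in Ioo 0 R, ((S - R) ^ (a - 1) * (R - t) ^ (b - 1)) • u t := by
    intro R
    simp only [mul_smul]
    exact (integral_smul _ _).symm
  simp only [h1]
  rw [h, ← integral_smul]
  refine setIntegral_congr_fun measurableSet_Ioo fun t ht => ?_
  have hSt : 0 < S - t := sub_pos.2 ht.2
  simp only
  rw [setIntegral_Ioo_eq_unit _ ht.2, smul_smul, betaInt]
  have h2 : ∀ v ∈ Ioo (0 : ℝ) 1,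
      ((S - (t + (S - t) * v)) ^ (a - 1) * (t + (S - t) * v - t) ^ (b - 1)) • u t =
      (((S - t) ^ (a - 1) * (S - t) ^ (b - 1)) * ((1 - v) ^ (a - 1) * v ^ (b - 1))) • u t := by
    intro v hv
    have e1 : S - (t + (S - t) * v) = (S - t) * (1 - v) := by ring
    have e2 : t + (S - t) * v - t = (S - t) * v := by ring
    rw [e1, e2, Real.mul_rpow hSt.le (by linarith [hv.2]), Real.mul_rpow hSt.le hv.1.le]
    ring_nf
  rw [setIntegral_congr_fun measurableSet_Ioo h2, integral_smul_const, smul_smul,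
    integral_const_mul]
  congr 1
  have e3 : (S - t) ^ (a + b - 1) = (S - t) * ((S - t) ^ (a - 1) * (S - t) ^ (b - 1)) := by
    rw [← Real.rpow_add hSt]
    nth_rewrite 2 [← Real.rpow_one (S - t)]
    rw [← Real.rpow_add hSt]
    congr 1
    ring
  rw [e3]
  ring

theorem eqOn_zero_of_setIntegral_eq_zero {u : ℝ → ℂ} (hu : Continuous u) {c : ℝ}
    (h : ∀ S ∈ Ioo 0 c, ∫ t in Ioo 0 S, u t = 0) : ∀ S ∈ Ioo 0 c, u S = 0 := by
  intro S hS
  have h1 : HasDerivAt (fun S => ∫ t in (0 : ℝ)..S, u t) (u S) S :=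
    intervalIntegral.integral_hasDerivAt_right (hu.intervalIntegrable _ _)
      (hu.stronglyMeasurableAtFilter _ _) hu.continuousAt
  have h2 : (fun S => ∫ t in (0 : ℝ)..S, u t) =ᶠ[𝓝 S] fun _ => 0 := by
    filter_upwards [isOpen_Ioo.mem_nhds hS] with x hx
    rw [intervalIntegral.integral_of_le hx.1.le, integral_Ioc_eq_integral_Ioo, h x hx]
  exact h1.unique ((hasDerivAt_const S (0 : ℂ)).congr_of_eventuallyEq h2)

/-- Order `n + 2` is, up to a positive factor, a primitive of order `n + 1`, so each differentiation
lowers the order by one. -/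
theorem eqOn_zero_of_fracInt_nat {u : ℝ → ℂ} (hu : Continuous u) {c : ℝ} (n : ℕ)
    (h : ∀ S ∈ Ioo 0 c, fracInt (n + 1 : ℝ) u S = 0) : ∀ S ∈ Ioo 0 c, u S = 0 := by
  induction n with
  | zero =>
    refine eqOn_zero_of_setIntegral_eq_zero hu fun S hS => ?_
    simpa [fracInt] using h S hS
  | succ n ih =>
    refine ih ?_
    have hcont : Continuous fun S : ℝ => ∫ t in (0 : ℝ)..S, ((S - t) ^ n : ℝ) • u t :=
      intervalIntegral.continuous_parametric_intervalIntegral_of_continuous (by fun_prop)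
        continuous_id
    have heq : ∀ S, 0 < S → fracInt (n + 1 : ℝ) u S =
        ∫ t in (0 : ℝ)..S, ((S - t) ^ n : ℝ) • u t := by
      intro S hS
      rw [fracInt, intervalIntegral.integral_of_le hS.le, integral_Ioc_eq_integral_Ioo]
      simp [Real.rpow_natCast]
    intro S hS
    rw [heq S hS.1]
    refine eqOn_zero_of_setIntegral_eq_zero hcont (fun T hT => ?_) S hS
    have h1 := fracInt_fracInt one_pos (by positivity : (0 : ℝ) < n + 1) hu T
    have h2 := h T hT
    push_cast at h2
    rw [add_comm (1 : ℝ), h2, smul_zero] at h1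
    rw [← h1, fracInt]
    refine setIntegral_congr_fun measurableSet_Ioo fun R hR => ?_
    simp [heq R hR.1]

/-- A half-integer order cannot be removed by differentiation alone; integrating once more to order
`d / 2` gives the integer order `d`. -/
theorem eqOn_zero_of_fracInt_half {u : ℝ → ℂ} (hu : Continuous u) {c : ℝ} {d : ℕ} (hd : 0 < d)
    (h : ∀ S ∈ Ioo 0 c, fracInt (d / 2 : ℝ) u S = 0) : ∀ S ∈ Ioo 0 c, u S = 0 := by
  have hα : (0 : ℝ) < d / 2 := by positivity
  obtain ⟨n, rfl⟩ := Nat.exists_eq_succ_of_ne_zero hd.ne'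
  refine eqOn_zero_of_fracInt_nat hu n fun S hS => ?_
  have h1 := fracInt_fracInt hα hα hu S
  rw [add_halves] at h1
  have h2 : fracInt ((n.succ : ℝ) / 2) (fracInt ((n.succ : ℝ) / 2) u) S = 0 := by
    rw [fracInt]
    refine (setIntegral_congr_fun measurableSet_Ioo fun t ht => ?_).trans
      (integral_zero (α := ℝ) (G := ℂ) (μ := volume.restrict (Ioo 0 S)))
    simp only [h t ⟨ht.1, ht.2.trans hS.2⟩, smul_zero]
  rw [h2] at h1
  have h3 := (smul_eq_zero.1 h1.symm).resolve_left (betaInt_pos hα hα).ne'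
  exact_mod_cast h3

theorem integrableOn_sub_rpow_smul {a : ℝ} (ha : 0 < a) (S : ℝ) {F : ℝ → ℂ} (hF : Continuous F) :
    IntegrableOn (fun t : ℝ => (S - t) ^ (a - 1) • F t) (Ioo 0 S) := by
  have h := (integrableOn_Icc_iff_integrableOn_Ioo).2 (integrableOn_sub_rpow ha 0 S)
  have h2 := h.smul_continuousOn hF.continuousOn isCompact_Icc
  exact h2.mono_set Ioo_subset_Icc_self

/-! ### Volterra equations of the first kind -/

theorem summable_of_le_pow_div_factorial {c : ℕ → ℝ} {A C : ℝ}
    (hc : ∀ k, |c k| ≤ C * (A ^ k / k.factorial)) (T : ℝ) :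
    Summable fun k => |c k| * |T| ^ k := by
  refine Summable.of_nonneg_of_le (fun k => by positivity) (fun k => ?_)
    ((Real.summable_pow_div_factorial (A * |T|)).mul_left C)
  calc |c k| * |T| ^ k ≤ C * (A ^ k / k.factorial) * |T| ^ k := by gcongr; exact hc k
    _ = C * ((A * |T|) ^ k / k.factorial) := by rw [mul_pow]; ring

theorem continuous_tsum_mul_pow {c : ℕ → ℝ} {A C : ℝ}
    (hc : ∀ k, |c k| ≤ C * (A ^ k / k.factorial)) :
    Continuous fun x : ℝ => ∑' k, c k * x ^ k := by
  rw [continuous_iff_continuousAt]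
  intro x
  have h : ContinuousOn (fun x : ℝ => ∑' k, c k * x ^ k) (Icc (x - 1) (x + 1)) := by
    refine continuousOn_tsum (fun k => by fun_prop)
      (summable_of_le_pow_div_factorial hc (|x| + 1)) fun k y hy => ?_
    rw [Real.norm_eq_abs, abs_mul, abs_pow, abs_of_nonneg (by positivity : 0 ≤ |x| + 1)]
    gcongr
    have h1 : |y - x| ≤ 1 := abs_le.2 ⟨by linarith [hy.1], by linarith [hy.2]⟩
    linarith [abs_sub_abs_le_abs_sub y x]
  exact h.continuousAt (Icc_mem_nhds (by linarith) (by linarith))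

/-- Every entire function `K`, given by a power series with factorial decay, is up to its constant
term the Abel transform of order `a` of another such function. -/
theorem exists_abel_kernel {a : ℝ} (ha : 0 < a) {c : ℕ → ℝ} {A C : ℝ} (hA : 0 ≤ A)
    (hc : ∀ k, |c k| ≤ C * (A ^ k / k.factorial)) :
    ∃ M : ℝ → ℝ, Continuous M ∧ ∀ x : ℝ,
      x * ∫ v in Ioo (0 : ℝ) 1, (1 - v) ^ (a - 1) * M (x * v) = ∑' k, c k * x ^ k - c 0 := by
  have hC : 0 ≤ C := by
    have := (abs_nonneg _).trans (hc 0)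
    simpa using this
  set B : ℕ → ℝ := fun k => ∫ v in Ioo (0 : ℝ) 1, (1 - v) ^ (a - 1) * v ^ k with hB
  have hint : ∀ k : ℕ, IntegrableOn (fun v : ℝ => (1 - v) ^ (a - 1) * v ^ k) (Ioo 0 1) := by
    intro k
    have h := integrableOn_beta ha (by positivity : (0 : ℝ) < k + 1)
    simpa [Real.rpow_natCast] using h
  -- The moments `B k` will be divided out. The mass on `(1/2, 1)` gives `B k ≥ δ 2⁻ᵏ`, so this
  -- division only replaces `A` by `2 A` in the factorial decay.
  set δ : ℝ := ∫ v in Ioo (1 / 2 : ℝ) 1, (1 - v) ^ (a - 1) with hδ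
  have hsub : Ioo (1 / 2 : ℝ) 1 ⊆ Ioo 0 1 := Ioo_subset_Ioo_left (by norm_num)
  have hδ0 : 0 < δ := by
    refine (setIntegral_pos_iff_support_of_nonneg_ae ?_ (integrableOn_sub_rpow ha _ _)).2 ?_
    · refine (ae_restrict_mem measurableSet_Ioo).mono fun v hv => ?_
      exact Real.rpow_nonneg (by linarith [hv.2]) _
    · refine lt_of_lt_of_le (b := volume (Ioo (1 / 2 : ℝ) 1)) (by norm_num)
        (measure_mono fun v hv => ⟨ne_of_gt ?_, hv⟩)
      exact Real.rpow_pos_of_pos (by linarith [hv.2]) _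
  have hBlow : ∀ k, δ * (1 / 2) ^ k ≤ B k := by
    intro k
    calc δ * (1 / 2) ^ k = ∫ v in Ioo (1 / 2 : ℝ) 1, (1 - v) ^ (a - 1) * (1 / 2) ^ k := by
          rw [integral_mul_const]
      _ ≤ ∫ v in Ioo (1 / 2 : ℝ) 1, (1 - v) ^ (a - 1) * v ^ k := by
          refine setIntegral_mono_on ((integrableOn_sub_rpow ha _ _).mul_const _)
            ((hint k).mono_set hsub) measurableSet_Ioo fun v hv => ?_
          have : 0 ≤ (1 - v) ^ (a - 1) := Real.rpow_nonneg (by linarith [hv.2]) _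
          gcongr
          exact hv.1.le
      _ ≤ B k := by
          refine setIntegral_mono_set (hint k) ?_ hsub.eventuallyLE
          refine (ae_restrict_mem measurableSet_Ioo).mono fun v hv => ?_
          exact mul_nonneg (Real.rpow_nonneg (by linarith [hv.2]) _) (pow_nonneg hv.1.le _)
  have hBpos : ∀ k, 0 < B k := fun k => (by positivity : 0 < δ * (1 / 2) ^ k).trans_le (hBlow k)
  -- These coefficients are forced: the Abel transform multiplies the `k`-th one by `B k`, and the
  -- factor `x` shifts the degree.
  set m : ℕ → ℝ := fun k => c (k + 1) / B k with hm
  have hmb : ∀ k, |m k| ≤ (C * A / δ) * ((2 * A) ^ k / k.factorial) := by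
    intro k
    rw [hm]
    simp only
    rw [abs_div, abs_of_pos (hBpos k)]
    calc |c (k + 1)| / B k ≤ (C * (A ^ (k + 1) / k.factorial)) / (δ * (1 / 2) ^ k) := by
          gcongr
          · refine (hc (k + 1)).trans ?_
            gcongr
            exact k.le_succ
          · exact hBlow k
      _ = (C * A / δ) * ((2 * A) ^ k / k.factorial) := by
          rw [mul_pow, pow_succ, one_div, inv_pow]
          field_simp
  refine ⟨fun x => ∑' k, m k * x ^ k, continuous_tsum_mul_pow hmb, fun x => ?_⟩
  have hsum := hasSum_integral_of_summable_integral_norm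
    (μ := volume.restrict (Ioo (0 : ℝ) 1))
    (F := fun k v => (m k * x ^ k) * ((1 - v) ^ (a - 1) * v ^ k))
    (fun k => (hint k).const_mul _) (by
      refine Summable.congr (f := fun k => |c (k + 1)| * |x| ^ k) ?_ fun k => ?_
      · refine summable_of_le_pow_div_factorial (c := fun k => c (k + 1)) (A := A) (C := C * A)
          (fun k => ?_) x
        refine (hc (k + 1)).trans ?_
        rw [pow_succ, mul_assoc, mul_comm A, div_mul_eq_mul_div]
        gcongr
        exact k.le_succ
      · have h1 : ∀ v ∈ Ioo (0 : ℝ) 1, ‖m k * x ^ k * ((1 - v) ^ (a - 1) * v ^ k)‖ =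
            |m k| * |x| ^ k * ((1 - v) ^ (a - 1) * v ^ k) := by
          intro v hv
          rw [Real.norm_eq_abs, abs_mul, abs_mul, abs_pow, abs_of_nonneg (mul_nonneg
            (Real.rpow_nonneg (by linarith [hv.2]) _) (pow_nonneg hv.1.le _))]
        rw [setIntegral_congr_fun measurableSet_Ioo h1, integral_const_mul]
        change _ = _ * B k
        rw [hm]
        simp only
        rw [abs_div, abs_of_pos (hBpos k)]
        field_simp [(hBpos k).ne'])
  have hterm : ∀ k, ∫ v in Ioo (0 : ℝ) 1, (m k * x ^ k) * ((1 - v) ^ (a - 1) * v ^ k) =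
      c (k + 1) * x ^ k := by
    intro k
    rw [integral_const_mul]
    change _ * B k = _
    rw [hm]
    simp only
    field_simp [(hBpos k).ne']
  simp only [hterm] at hsum
  have hR : ∫ v in Ioo (0 : ℝ) 1, (1 - v) ^ (a - 1) * ∑' k, m k * (x * v) ^ k =
      ∑' k, c (k + 1) * x ^ k := by
    rw [hsum.tsum_eq]
    congr 1
    ext v
    rw [← tsum_mul_left]
    congr 1
    ext k
    rw [mul_pow]
    ring
  rw [hR, ← tsum_mul_left]
  have hs : Summable fun k => c k * x ^ k := by
    refine Summable.of_norm ?_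
    simpa [abs_mul, abs_pow] using summable_of_le_pow_div_factorial hc x
  rw [hs.tsum_eq_zero_add]
  simp only [pow_zero, mul_one, add_sub_cancel_left]
  congr 1
  ext k
  ring

/-- Grönwall's lemma for a linear Volterra inequality. -/
theorem eqOn_zero_of_norm_le_integral {u : ℝ → ℂ} (hu : Continuous u) {T L : ℝ} (hL : 0 ≤ L)
    (h : ∀ S ∈ Ioc 0 T, ‖u S‖ ≤ L * ∫ t in Ioo 0 S, ‖u t‖) : ∀ S ∈ Ioc 0 T, u S = 0 := by
  obtain ⟨A, hA⟩ := (isCompact_Icc (a := (0 : ℝ)) (b := T)).exists_bound_of_continuousOn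
    hu.continuousOn
  -- Iterating the inequality gains a factor `L S / n` at each stage, and the resulting bound tends
  -- to `0`.
  have key : ∀ n : ℕ, ∀ S ∈ Ioc 0 T, ‖u S‖ ≤ A * ((L * S) ^ n / n.factorial) := by
    intro n
    induction n with
    | zero => intro S hS; simpa using hA S ⟨hS.1.le, hS.2⟩
    | succ n ih =>
      intro S hS
      have hint : IntegrableOn (fun t => A * ((L * t) ^ n / n.factorial)) (Ioo 0 S) :=
        ((by fun_prop : Continuous fun t : ℝ => A * ((L * t) ^ n / n.factorial)).integrableOn_Icc
          ).mono_set Ioo_subset_Icc_self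
      calc ‖u S‖ ≤ L * ∫ t in Ioo 0 S, ‖u t‖ := h S hS
        _ ≤ L * ∫ t in Ioo 0 S, A * ((L * t) ^ n / n.factorial) := by
          gcongr ?_ * ?_
          refine setIntegral_mono_on (hu.norm.integrableOn_Icc.mono_set Ioo_subset_Icc_self) hint
            measurableSet_Ioo fun t ht => ih t ⟨ht.1, ht.2.le.trans hS.2⟩
        _ = A * ((L * S) ^ (n + 1) / (n + 1).factorial) := by
          have e : ∀ t : ℝ, A * ((L * t) ^ n / n.factorial) =
              (A * L ^ n / n.factorial) * t ^ n := by intro t; rw [mul_pow]; ring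
          simp only [e]
          rw [integral_const_mul, ← integral_Ioc_eq_integral_Ioo,
            ← intervalIntegral.integral_of_le hS.1.le, integral_pow, Nat.factorial_succ]
          push_cast
          field_simp
          rw [zero_pow n.succ_ne_zero, sub_zero]
          ring
  intro S hS
  have hlim := ((FloorSemiring.tendsto_pow_div_factorial_atTop (L * S)).const_mul A)
  rw [mul_zero] at hlim
  exact norm_le_zero_iff.1 (ge_of_tendsto' hlim fun n => key n S hS)

/-- Uniqueness for a Volterra equation of the first kind with an Abel type kernel. -/
theorem eqOn_zero_of_abel_volterra {d : ℕ} (hd : 0 < d) {c : ℕ → ℝ} {A C : ℝ} (hA : 0 ≤ A)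
    (hc : ∀ k, |c k| ≤ C * (A ^ k / k.factorial)) (hc0 : c 0 ≠ 0) {u : ℝ → ℂ} (hu : Continuous u)
    {T : ℝ} (h : ∀ R ∈ Ioo 0 T,
      ∫ t in Ioo 0 R, ((R - t) ^ ((d : ℝ) / 2 - 1) * ∑' k, c k * (t * (R - t)) ^ k) • u t = 0) :
    ∀ t ∈ Ioo 0 T, u t = 0 := by
  have hα : (0 : ℝ) < d / 2 := by positivity
  set α : ℝ := (d : ℝ) / 2 with hαdef
  obtain ⟨M, hM, hMK⟩ := exists_abel_kernel hα hA hc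
  have hK := continuous_tsum_mul_pow hc
  -- Fractional integration of `t M(t (R - t))` over `t < R < S` gives `(S - t)^(α - 1) (K(x) - c
  -- 0)` at `x = t (S - t)`; the factor `x` in `hMK` supplies the `t` and the Jacobian `S - t`.
  set F : ℝ × ℝ → ℂ := fun p => (p.2 * M (p.2 * (p.1 - p.2))) • u p.2 with hF
  have hFc : Continuous F := by rw [hF]; fun_prop
  set V : ℝ → ℂ := fun S => ∫ t in (0 : ℝ)..S, F (S, t) with hV
  have hVc : Continuous V :=
    intervalIntegral.continuous_parametric_intervalIntegral_of_continuous (f := fun S t => F (S, t))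
      hFc continuous_id
  have hVeq : ∀ S, 0 ≤ S → V S = ∫ t in Ioo 0 S, F (S, t) := fun S hS => by
    rw [hV]
    simp only
    rw [intervalIntegral.integral_of_le hS, integral_Ioc_eq_integral_Ioo]
  have hVint : ∀ S, fracInt α V S = ∫ t in Ioo 0 S, ((S - t) ^ (α - 1)) •
      (((∑' k, c k * (t * (S - t)) ^ k) - c 0) • u t) := by
    intro S
    have h1 := abel_fubini hα one_pos (S := S) hFc
    simp only [sub_self, Real.rpow_zero, mul_one] at h1
    have h2 : fracInt α V S =
        ∫ R in Ioo 0 S, ∫ t in Ioo 0 R, (S - R) ^ (α - 1) • F (R, t) := by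
      rw [fracInt]
      refine setIntegral_congr_fun measurableSet_Ioo fun R hR => ?_
      simp only [hVeq R hR.1.le]
      exact (integral_smul _ _).symm
    rw [h2, h1]
    refine setIntegral_congr_fun measurableSet_Ioo fun t ht => ?_
    have hSt : 0 < S - t := sub_pos.2 ht.2
    rw [setIntegral_Ioo_eq_unit _ ht.2, ← hMK (t * (S - t))]
    have h3 : ∀ v ∈ Ioo (0 : ℝ) 1,
        (S - (t + (S - t) * v)) ^ (α - 1) • F (t + (S - t) * v, t) =
        (((S - t) ^ (α - 1) * t) * ((1 - v) ^ (α - 1) * M (t * (S - t) * v))) • u t := by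
      intro v hv
      have e1 : S - (t + (S - t) * v) = (S - t) * (1 - v) := by ring
      have e2 : t * (t + (S - t) * v - t) = t * (S - t) * v := by ring
      rw [hF]
      simp only
      rw [e1, e2, Real.mul_rpow hSt.le (by linarith [hv.2]), smul_smul]
      ring_nf
    rw [setIntegral_congr_fun measurableSet_Ioo h3, integral_smul_const, integral_const_mul,
      smul_smul, smul_smul]
    ring_nf
  -- The hypothesis says that the fractional integral of `G` vanishes, so `G = 0` is an equation of
  -- the second kind for `u`.
  set G : ℝ → ℂ := fun S => c 0 • u S + V S with hG
  have hGc : Continuous G := by rw [hG]; fun_prop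
  have hGzero : ∀ S ∈ Ioo 0 T, G S = 0 := by
    refine eqOn_zero_of_fracInt_half hGc hd fun S hS => ?_
    have h1 : fracInt α G S = (∫ t in Ioo 0 S, ((S - t) ^ (α - 1)) • (c 0 • u t)) +
        fracInt α V S := by
      rw [fracInt, fracInt, ← integral_add
        (integrableOn_sub_rpow_smul hα S (show Continuous fun t => c 0 • u t by fun_prop))
        (integrableOn_sub_rpow_smul hα S hVc)]
      simp only [hG, smul_add]
    have hKc : Continuous fun t => ((∑' k, c k * (t * (S - t)) ^ k) - c 0) • u t :=
      ((hK.comp (by fun_prop : Continuous fun t : ℝ => t * (S - t))).sub continuous_const).smul hu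
    rw [h1, hVint, ← integral_add
        (integrableOn_sub_rpow_smul hα S (show Continuous fun t => c 0 • u t by fun_prop))
        (integrableOn_sub_rpow_smul hα S hKc), ← h S hS]
    congr 1
    ext t
    rw [← smul_add, ← add_smul, smul_smul]
    ring_nf
  intro S hS
  obtain ⟨L, hL⟩ := ((isCompact_Icc (a := (0 : ℝ)) (b := S)).prod
      (isCompact_Icc (a := (0 : ℝ)) (b := S))).exists_bound_of_continuousOn
      (f := fun p : ℝ × ℝ => (c 0)⁻¹ * (p.2 * M (p.2 * (p.1 - p.2))))
      (by fun_prop)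
  have hL0 : 0 ≤ L := (norm_nonneg _).trans
    (hL (0, 0) ⟨⟨le_rfl, hS.1.le⟩, ⟨le_rfl, hS.1.le⟩⟩)
  refine eqOn_zero_of_norm_le_integral hu (T := S) hL0 (fun R hR => ?_) S ⟨hS.1, le_rfl⟩
  have h1 := hGzero R ⟨hR.1, hR.2.trans_lt hS.2⟩
  rw [hG] at h1
  simp only at h1
  rw [hVeq R hR.1.le] at h1
  have h2 : u R = -∫ t in Ioo 0 R, (c 0)⁻¹ • F (R, t) := by
    have e : ∫ t in Ioo 0 R, (c 0)⁻¹ • F (R, t) = (c 0)⁻¹ • ∫ t in Ioo 0 R, F (R, t) :=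
      integral_smul _ _
    rw [e, eq_neg_of_add_eq_zero_right h1, smul_neg, neg_neg, smul_smul, inv_mul_cancel₀ hc0,
      one_smul]
  rw [h2, norm_neg, ← integral_const_mul]
  refine norm_integral_le_of_norm_le
    ((hu.norm.integrableOn_Icc.mono_set Ioo_subset_Icc_self).const_mul L) ?_
  refine (ae_restrict_mem measurableSet_Ioo).mono fun t ht => ?_
  rw [hF]
  simp only
  rw [smul_smul, norm_smul]
  gcongr
  exact hL (R, t) ⟨⟨hR.1.le, hR.2⟩, ⟨ht.1.le, ht.2.le.trans hR.2⟩⟩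

/-! ### Polar coordinates and spherical averages -/

section Polar
variable {E : Type*} [NormedAddCommGroup E] [MeasurableSpace E] [BorelSpace E]

/-- Integration in polar coordinates. -/
theorem integral_polar [NormedSpace ℝ E] [Nontrivial E] [FiniteDimensional ℝ E] (μ : Measure E)
    [μ.IsAddHaarMeasure] {f : E → ℂ} (hf : Integrable f μ) :
    ∫ y, f y ∂μ = ∫ s in Ioi (0 : ℝ), s ^ (Module.finrank ℝ E - 1) •
      ∫ ω : sphere (0 : E) 1, f (s • (ω : E)) ∂μ.toSphere := by
  set g : sphere (0 : E) 1 × Ioi (0 : ℝ) → ℂ := fun p => f ((p.2 : ℝ) • (p.1 : E)) with hg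
  have hcomp : ∀ x : ({0}ᶜ : Set E), g (homeomorphUnitSphereProd E x) = f x := by
    intro x
    have hx : ‖(x : E)‖ ≠ 0 := norm_ne_zero_iff.2 x.2
    simp [hg, smul_smul, hx]
  have hmp := μ.measurePreserving_homeomorphUnitSphereProd
  have hemb := (homeomorphUnitSphereProd E).measurableEmbedding
  have hgi : Integrable g
      (μ.toSphere.prod (Measure.volumeIoiPow (Module.finrank ℝ E - 1))) := by
    rw [← hmp.integrable_comp_emb hemb]
    have h1 : g ∘ (homeomorphUnitSphereProd E) = f ∘ ((↑) : ({0}ᶜ : Set E) → E) := funext hcomp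
    rw [h1, ← integrableOn_iff_comap_subtypeVal (measurableSet_singleton _).compl]
    exact hf.integrableOn
  calc ∫ y, f y ∂μ = ∫ x : ({0}ᶜ : Set E), f x ∂(μ.comap (↑)) := by
        rw [integral_subtype_comap (measurableSet_singleton _).compl f, restrict_compl_singleton]
    _ = ∫ p, g p ∂(μ.toSphere.prod (Measure.volumeIoiPow (Module.finrank ℝ E - 1))) := by
        rw [← hmp.integral_comp hemb]
        simp only [hcomp]
    _ = ∫ s : Ioi (0 : ℝ), (∫ ω : sphere (0 : E) 1, f ((s : ℝ) • (ω : E)) ∂μ.toSphere)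
          ∂(Measure.volumeIoiPow (Module.finrank ℝ E - 1)) := integral_prod_symm g hgi
    _ = _ := by
        simp only [Measure.volumeIoiPow, ENNReal.ofReal]
        rw [integral_withDensity_eq_integral_smul, integral_subtype_comap measurableSet_Ioi
          fun a : ℝ => Real.toNNReal (a ^ (Module.finrank ℝ E - 1)) •
            ∫ ω : sphere (0 : E) 1, f (a • (ω : E)) ∂μ.toSphere,
          setIntegral_congr_fun measurableSet_Ioi fun x hx => ?_]
        · rw [NNReal.smul_def, Real.coe_toNNReal _ (pow_nonneg hx.out.le _)]
        · exact (measurable_subtype_coe.pow_const _).real_toNNReal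

variable [InnerProductSpace ℝ E]

/-- The Taylor coefficients of the spherical average of `cos ⟪·, ζ⟫`, as a function of the squared
radius. -/
def sphereCosCoeff (μ : Measure E) (ζ : E) (k : ℕ) : ℝ :=
  ∫ ω : sphere (0 : E) 1, (-1) ^ k * (inner ℝ (ω : E) ζ) ^ (2 * k) / (2 * k).factorial ∂μ.toSphere

variable [FiniteDimensional ℝ E] (μ : Measure E) [μ.IsAddHaarMeasure]

theorem norm_sphereCos_term_le {E : Type*} [NormedAddCommGroup E] [InnerProductSpace ℝ E]
    (ζ : E) (k : ℕ) (ω : sphere (0 : E) 1) :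
    ‖(-1) ^ k * (inner ℝ (ω : E) ζ) ^ (2 * k) / (2 * k).factorial‖ ≤
      (‖ζ‖ ^ 2) ^ k / k.factorial := by
  have hω : ‖(ω : E)‖ = 1 := by simp
  have h1 : |inner ℝ (ω : E) ζ| ≤ ‖ζ‖ := by
    simpa [hω] using abs_real_inner_le_norm (ω : E) ζ
  rw [norm_div, norm_mul, norm_pow, norm_neg, norm_one, one_pow, one_mul, norm_pow,
    Real.norm_eq_abs, Real.norm_natCast, ← pow_mul]
  gcongr
  omega

theorem abs_sphereCosCoeff_le (ζ : E) (k : ℕ) :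
    |sphereCosCoeff μ ζ k| ≤ μ.toSphere.real univ * ((‖ζ‖ ^ 2) ^ k / k.factorial) := by
  rw [sphereCosCoeff, ← Real.norm_eq_abs, mul_comm (μ.toSphere.real univ)]
  exact norm_integral_le_of_norm_le_const (μ := μ.toSphere)
    (Eventually.of_forall (norm_sphereCos_term_le ζ k))

theorem sphereCosCoeff_zero_ne_zero [Nontrivial E] (ζ : E) : sphereCosCoeff μ ζ 0 ≠ 0 := by
  have h : μ.toSphere.real univ ≠ 0 := by
    rw [Measure.toSphere_real_apply_univ]
    exact mul_ne_zero (Nat.cast_ne_zero.2 Module.finrank_pos.ne')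
      (ENNReal.toReal_pos (measure_ball_pos μ _ one_pos).ne' measure_ball_lt_top.ne).ne'
  simpa [sphereCosCoeff] using h

/-- Termwise integration of the cosine series. Only even powers of `z` occur, so the average is a
power series in `z ^ 2`, which later equals `t (R - t)`. -/
theorem integral_sphere_cos (ζ : E) (z : ℝ) :
    ∫ ω : sphere (0 : E) 1, Real.cos (z * inner ℝ (ω : E) ζ) ∂μ.toSphere =
      ∑' k, sphereCosCoeff μ ζ k * (z ^ 2) ^ k := by
  have hc : ∀ k, Continuous fun ω : sphere (0 : E) 1 =>
      (z ^ 2) ^ k * ((-1) ^ k * (inner ℝ (ω : E) ζ) ^ (2 * k) / (2 * k).factorial) := by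
    intro k; fun_prop
  have hb : ∀ k (ω : sphere (0 : E) 1),
      ‖(z ^ 2) ^ k * ((-1) ^ k * (inner ℝ (ω : E) ζ) ^ (2 * k) / (2 * k).factorial)‖ ≤
        (z ^ 2 * ‖ζ‖ ^ 2) ^ k / k.factorial := by
    intro k ω
    rw [norm_mul, Real.norm_of_nonneg (by positivity : 0 ≤ (z ^ 2) ^ k)]
    exact (mul_le_mul_of_nonneg_left (norm_sphereCos_term_le ζ k ω) (by positivity)).trans_eq
      (by rw [mul_pow, mul_div_assoc])
  have h := hasSum_integral_of_dominated_convergence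
    (μ := μ.toSphere) (f := fun ω => Real.cos (z * inner ℝ (ω : E) ζ))
    (fun (k : ℕ) (_ : sphere (0 : E) 1) => (z ^ 2 * ‖ζ‖ ^ 2) ^ k / k.factorial)
    (fun k => (hc k).aestronglyMeasurable) (fun k => Eventually.of_forall (hb k))
    (Eventually.of_forall fun _ => Real.summable_pow_div_factorial _)
    (integrable_const _)
    (Eventually.of_forall fun ω => by
      refine (Real.hasSum_cos (z * inner ℝ (ω : E) ζ)).congr_fun fun k => ?_
      rw [mul_pow, ← pow_mul]
      ring)
  rw [← h.tsum_eq]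
  congr 1
  ext k
  rw [integral_const_mul, sphereCosCoeff, mul_comm]

theorem continuous_horosphere_height {E : Type*} [NormedAddCommGroup E] {R : ℝ} :
    Continuous fun y : E => R / (1 + ‖y‖ ^ 2) :=
  continuous_const.div (by fun_prop) fun y => by positivity

/-- The substitution `t = R / (1 + s ^ 2)`. -/
theorem setIntegral_Ioo_eq_Ioi {R : ℝ} (hR : 0 < R) (w : ℝ → ℂ) :
    ∫ t in Ioo 0 R, w t =
      ∫ s in Ioi (0 : ℝ), (2 * R * s / (1 + s ^ 2) ^ 2) • w (R / (1 + s ^ 2)) := by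
  have himg : (fun s : ℝ => R / (1 + s ^ 2)) '' Ioi 0 = Ioo 0 R := by
    ext t
    constructor
    · rintro ⟨s, hs, rfl⟩
      have hs0 : (0 : ℝ) < s := hs
      refine ⟨by positivity, ?_⟩
      rw [div_lt_iff₀ (by positivity)]
      nlinarith [mul_pos hR (pow_pos hs0 2)]
    · rintro ⟨h0, h1⟩
      have h2 : 0 < (R - t) / t := div_pos (by linarith) h0
      refine ⟨√((R - t) / t), Real.sqrt_pos.2 h2, ?_⟩
      simp only
      rw [Real.sq_sqrt h2.le]
      field_simp
      ring
  rw [← himg, integral_image_eq_integral_abs_deriv_smul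
    (f' := fun s => -(2 * R * s / (1 + s ^ 2) ^ 2))
    measurableSet_Ioi]
  · refine setIntegral_congr_fun measurableSet_Ioi fun s hs => ?_
    have hs0 : (0 : ℝ) < s := hs
    rw [abs_neg, abs_of_nonneg (by positivity)]
  · intro s hs
    refine HasDerivAt.hasDerivWithinAt ?_
    have h1 : HasDerivAt (fun s : ℝ => 1 + s ^ 2) (2 * s) s := by
      simpa using (hasDerivAt_pow 2 s).const_add 1
    refine ((hasDerivAt_const s R).div h1 (by positivity)).congr_deriv ?_
    ring
  · intro s hs t ht hst
    have hs0 : (0 : ℝ) < s := hs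
    have ht0 : (0 : ℝ) < t := ht
    simp only at hst
    rw [div_eq_div_iff (by positivity) (by positivity)] at hst
    have h1 : t ^ 2 = s ^ 2 := by
      have := mul_left_cancel₀ hR.ne' hst
      linarith
    exact ((pow_left_inj₀ ht0.le hs0.le two_ne_zero).1 h1).symm

theorem integrable_cos_smul_horosphere_height [Nontrivial E] {h : ℝ → ℂ}
    (hc : ContinuousOn h (Ioi 0)) {C R : ℝ}
    (hb : ∀ t, 0 < t → t ≤ R → ‖h t‖ ≤ C * t ^ Module.finrank ℝ E) (hR : 0 < R) (ζ : E) :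
    Integrable (fun y : E => Real.cos (R / (1 + ‖y‖ ^ 2) * inner ℝ y ζ) •
      h (R / (1 + ‖y‖ ^ 2))) μ := by
  have hd : 0 < Module.finrank ℝ E := Module.finrank_pos
  have hpos : ∀ y : E, 0 < R / (1 + ‖y‖ ^ 2) := fun y => by positivity
  have hcont : Continuous fun y : E => R / (1 + ‖y‖ ^ 2) := continuous_horosphere_height
  have h1 : Continuous fun y : E => h (R / (1 + ‖y‖ ^ 2)) :=
    hc.comp_continuous hcont hpos
  -- The bound `C t ^ d` with `t = R / (1 + ‖y‖²)` decays like `‖y‖ ^ (-2 d)`, and `2 d > d`.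
  have h2 := (integrable_rpow_neg_one_add_norm_sq (E := E) (μ := μ)
    (r := 2 * Module.finrank ℝ E) (by
      have : (0 : ℝ) < Module.finrank ℝ E := by exact_mod_cast hd
      linarith)).const_mul (C * R ^ Module.finrank ℝ E)
  have h3 : Continuous fun y : E => Real.cos (R / (1 + ‖y‖ ^ 2) * inner ℝ y ζ) :=
    Real.continuous_cos.comp (hcont.mul (by fun_prop))
  refine h2.mono' (h3.smul h1).aestronglyMeasurable
    (Eventually.of_forall fun y => ?_)
  rw [norm_smul]
  calc _ ≤ 1 * (C * (R / (1 + ‖y‖ ^ 2)) ^ Module.finrank ℝ E) := by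
        gcongr
        · exact Real.abs_cos_le_one _
        · exact hb _ (hpos y) (div_le_self hR.le (by nlinarith [sq_nonneg ‖y‖]))
    _ = _ := by
        rw [neg_div, mul_div_cancel_left₀ _ two_ne_zero, Real.rpow_neg (by positivity),
          Real.rpow_natCast, div_pow]
        ring

/-- The bridge from the sphere to the Abel equation: with `s = ‖y‖` and `t = R / (1 + s²)`, one has
`R - t = t s²`, so the phase `t s` has square `t (R - t)`. The powers of `t` and `R - t` come from
`s ^ (d - 1) ds`. -/
theorem integral_cos_smul_horosphere_height [Nontrivial E] {h : ℝ → ℂ}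
    (hc : ContinuousOn h (Ioi 0)) {C R : ℝ}
    (hb : ∀ t, 0 < t → t ≤ R → ‖h t‖ ≤ C * t ^ Module.finrank ℝ E) (hR : 0 < R) (ζ : E) :
    ∫ t in Ioo 0 R, ((R - t) ^ ((Module.finrank ℝ E : ℝ) / 2 - 1) *
        ∑' k, sphereCosCoeff μ ζ k * (t * (R - t)) ^ k) •
          (t ^ (-((Module.finrank ℝ E : ℝ) / 2) - 1) • h t) =
      (2 / R) • ∫ y : E, Real.cos (R / (1 + ‖y‖ ^ 2) * inner ℝ y ζ) •
        h (R / (1 + ‖y‖ ^ 2)) ∂μ := by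
  have hd : 0 < Module.finrank ℝ E := Module.finrank_pos
  rw [integral_polar μ (integrable_cos_smul_horosphere_height μ hc hb hR ζ),
    setIntegral_Ioo_eq_Ioi hR, ← integral_smul]
  refine setIntegral_congr_fun measurableSet_Ioi fun s hs => ?_
  have hs0 : (0 : ℝ) < s := hs
  have hnorm : ∀ ω : sphere (0 : E) 1, ‖s • (ω : E)‖ = s := fun ω => by
    rw [norm_smul]; simp [abs_of_pos hs0]
  simp only [hnorm, real_inner_smul_left, ← mul_assoc]
  rw [integral_smul_const, integral_sphere_cos]
  set q : ℝ := 1 + s ^ 2 with hq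
  have hq0 : 0 < q := by positivity
  have e1 : R - R / q = R / q * s ^ 2 := by
    rw [hq]; field_simp; ring
  have e2 : R / q * (R - R / q) = (R / q * s) ^ 2 := by rw [e1]; ring
  rw [e2, smul_smul, smul_smul, smul_smul, smul_smul, e1,
    Real.mul_rpow (by positivity) (by positivity)]
  congr 1
  have e3 : (s ^ 2) ^ ((Module.finrank ℝ E : ℝ) / 2 - 1) * s = s ^ (Module.finrank ℝ E - 1) := by
    rw [← Real.rpow_natCast s 2, ← Real.rpow_mul hs0.le]
    nth_rewrite 2 [← Real.rpow_one s]
    rw [← Real.rpow_add hs0, ← Real.rpow_natCast s (_ - 1), Nat.cast_pred hd]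
    congr 1
    push_cast
    ring
  have e4 : (R / q) ^ ((Module.finrank ℝ E : ℝ) / 2 - 1) *
      (R / q) ^ (-((Module.finrank ℝ E : ℝ) / 2) - 1) = (q / R) ^ 2 := by
    rw [← Real.rpow_add (by positivity), ← inv_div R q, inv_pow, ← Real.rpow_natCast,
      ← Real.rpow_neg (by positivity)]
    congr 1
    push_cast
    ring
  rw [← e3]
  set K := ∑' k, sphereCosCoeff μ ζ k * ((R / q * s) ^ 2) ^ k
  calc _ = (2 * R / q ^ 2) * ((R / q) ^ ((Module.finrank ℝ E : ℝ) / 2 - 1) *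
      (R / q) ^ (-((Module.finrank ℝ E : ℝ) / 2) - 1)) *
        ((s ^ 2) ^ ((Module.finrank ℝ E : ℝ) / 2 - 1) * s) * K := by ring
    _ = _ := by
      rw [e4]
      field_simp

end Polar

/-! ### Fourier transform in the point of tangency -/

section Core
variable {E : Type*} [NormedAddCommGroup E] [InnerProductSpace ℝ E] [FiniteDimensional ℝ E]
  [MeasurableSpace E] [BorelSpace E]

theorem integrable_one_add_norm_pow_inv {N : ℕ} (hN : Module.finrank ℝ E < N) :
    Integrable fun x : E => ((1 + ‖x‖) ^ N)⁻¹ := by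
  have h := integrable_one_add_norm (E := E) (μ := volume) (r := N) (by exact_mod_cast hN)
  refine h.congr (Eventually.of_forall fun x => ?_)
  simp only
  rw [Real.rpow_neg (by positivity), Real.rpow_natCast]

theorem integrable_one_add_norm_sq_pow_inv {N : ℕ} (hN : Module.finrank ℝ E < N) :
    Integrable fun x : E => ((1 + ‖x‖ ^ 2) ^ N)⁻¹ := by
  have h := integrable_rpow_neg_one_add_norm_sq (E := E) (μ := volume) (r := 2 * N) (by
    have : (Module.finrank ℝ E : ℝ) < N := by exact_mod_cast hN
    have h2 : (0 : ℝ) ≤ Module.finrank ℝ E := by positivity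
    linarith)
  refine h.congr (Eventually.of_forall fun x => ?_)
  simp only
  rw [neg_div, mul_div_cancel_left₀ _ two_ne_zero, Real.rpow_neg (by positivity),
    Real.rpow_natCast]

variable {g : E → ℝ → ℂ} {C : ℝ} {N : ℕ}

theorem continuous_slice {E : Type*} [NormedAddCommGroup E] {g : E → ℝ → ℂ}
    (hg : ContinuousOn (Function.uncurry g) {p | 0 < p.2}) {t : ℝ} (ht : 0 < t) :
    Continuous fun x => g x t :=
  hg.comp_continuous (f := fun x : E => (x, t)) (by fun_prop) fun _ => ht

theorem integrable_slice (hN : Module.finrank ℝ E < N)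
    (hg : ContinuousOn (Function.uncurry g) {p | 0 < p.2})
    (hb : ∀ x t, 0 < t → ‖g x t‖ ≤ C * (t / (1 + ‖x‖)) ^ N) {t : ℝ} (ht : 0 < t) :
    Integrable fun x => g x t := by
  refine ((integrable_one_add_norm_pow_inv hN).const_mul (C * t ^ N)).mono'
    (continuous_slice hg ht).aestronglyMeasurable (Eventually.of_forall fun x => ?_)
  refine (hb x t ht).trans_eq ?_
  rw [div_pow]
  ring

theorem continuousOn_fourier_slice (hN : Module.finrank ℝ E < N)
    (hg : ContinuousOn (Function.uncurry g) {p | 0 < p.2})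
    (hb : ∀ x t, 0 < t → ‖g x t‖ ≤ C * (t / (1 + ‖x‖)) ^ N) (η : E) :
    ContinuousOn (fun t => 𝓕 (fun x => g x t) η) (Ioi 0) := by
  have hC : 0 ≤ C := by simpa using (norm_nonneg _).trans (hb 0 1 one_pos)
  intro t₀ ht₀
  have ht₀' : (0 : ℝ) < t₀ := ht₀
  refine ContinuousAt.continuousWithinAt ?_
  simp only [Real.fourier_eq]
  have hev : ∀ᶠ t in 𝓝 t₀, t ∈ Ioo 0 (t₀ + 1) :=
    Ioo_mem_nhds ht₀' (by linarith)
  refine continuousAt_of_dominated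
    (bound := fun x => C * (t₀ + 1) ^ N * ((1 + ‖x‖) ^ N)⁻¹) ?_ ?_
    ((integrable_one_add_norm_pow_inv hN).const_mul _) (Eventually.of_forall fun x => ?_)
  · filter_upwards [hev] with t ht
    have h1 := continuous_slice hg ht.1
    exact (Continuous.smul (by fun_prop) h1).aestronglyMeasurable
  · filter_upwards [hev] with t ht
    refine Eventually.of_forall fun x => ?_
    rw [Circle.norm_smul]
    refine (hb x t ht.1).trans ?_
    rw [div_pow, div_eq_mul_inv, ← mul_assoc]
    have := ht.1
    gcongr
    exact ht.2.le
  · have h1 : ContinuousAt (Function.uncurry g) (x, t₀) :=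
      hg.continuousAt ((isOpen_lt continuous_const continuous_snd).mem_nhds ht₀)
    have h2 : ContinuousAt (fun t => g x t) t₀ :=
      ContinuousAt.comp (f := fun t : ℝ => (x, t)) h1 (by fun_prop)
    exact h2.const_smul _

theorem norm_fourier_slice_le (hN : Module.finrank ℝ E < N)
    (hb : ∀ x t, 0 < t → ‖g x t‖ ≤ C * (t / (1 + ‖x‖)) ^ N) (η : E) {t : ℝ} (ht : 0 < t) :
    ‖𝓕 (fun x => g x t) η‖ ≤ (C * ∫ x : E, ((1 + ‖x‖) ^ N)⁻¹) * t ^ N := by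
  rw [Real.fourier_eq]
  have h1 : Integrable fun x : E => (C * t ^ N) * ((1 + ‖x‖) ^ N)⁻¹ :=
    (integrable_one_add_norm_pow_inv hN).const_mul _
  refine (norm_integral_le_of_norm_le h1 (Eventually.of_forall fun x => ?_)).trans_eq ?_
  · rw [Circle.norm_smul]
    refine (hb x t ht).trans_eq ?_
    rw [div_pow]
    ring
  · rw [integral_const_mul]
    ring

/-- Since `‖y‖ ≤ 1 + ‖y‖²`, the shift `t y` has norm at most `R`. Hence `1 + ‖b‖ ≤ (1 + R) (1 + ‖b +
t y‖)`, and the decay splits into a factor in `b` and a factor in `y`. -/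
theorem integrable_horosphere_family (hN : Module.finrank ℝ E < N)
    (hg : ContinuousOn (Function.uncurry g) {p | 0 < p.2})
    (hb : ∀ x t, 0 < t → ‖g x t‖ ≤ C * (t / (1 + ‖x‖)) ^ N) (η : E) {R : ℝ} (hR : 0 < R) :
    Integrable (fun p : E × E => 𝐞 (-inner ℝ p.1 η) •
      g (p.1 + (R / (1 + ‖p.2‖ ^ 2)) • p.2) (R / (1 + ‖p.2‖ ^ 2))) (volume.prod volume) := by
  have hC : 0 ≤ C := by simpa using (norm_nonneg _).trans (hb 0 1 one_pos)
  have hpos : ∀ y : E, 0 < R / (1 + ‖y‖ ^ 2) := fun y => by positivity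
  have hcont : Continuous fun y : E => R / (1 + ‖y‖ ^ 2) := continuous_horosphere_height
  have hcont' : Continuous fun p : E × E => R / (1 + ‖p.2‖ ^ 2) := hcont.comp continuous_snd
  have h1 : Continuous fun p : E × E =>
      g (p.1 + (R / (1 + ‖p.2‖ ^ 2)) • p.2) (R / (1 + ‖p.2‖ ^ 2)) :=
    hg.comp_continuous (f := fun p : E × E =>
      (p.1 + (R / (1 + ‖p.2‖ ^ 2)) • p.2, R / (1 + ‖p.2‖ ^ 2)))
      ((continuous_fst.add (hcont'.smul continuous_snd)).prodMk hcont') fun p => hpos p.2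
  have h2 := ((integrable_one_add_norm_pow_inv hN).mul_prod
    (integrable_one_add_norm_sq_pow_inv hN)).const_mul (C * (R * (1 + R)) ^ N)
  refine h2.mono' (Continuous.smul (by fun_prop) h1).aestronglyMeasurable
    (Eventually.of_forall fun p => ?_)
  obtain ⟨b, y⟩ := p
  rw [Circle.norm_smul]
  simp only
  refine (hb _ _ (hpos y)).trans ?_
  rw [mul_assoc, ← mul_inv, ← mul_pow, ← inv_pow, ← mul_pow]
  gcongr
  have h3 : ‖(R / (1 + ‖y‖ ^ 2)) • y‖ ≤ R := by
    rw [norm_smul, Real.norm_of_nonneg (hpos y).le, div_mul_eq_mul_div,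
      div_le_iff₀ (by positivity)]
    have : ‖y‖ ≤ 1 + ‖y‖ ^ 2 := by nlinarith [sq_nonneg (‖y‖ - 1)]
    gcongr
  set w := (R / (1 + ‖y‖ ^ 2)) • y with hw
  have h4 : 1 + ‖b‖ ≤ (1 + R) * (1 + ‖b + w‖) := by
    have h5 : ‖b‖ ≤ ‖b + w‖ + ‖w‖ := by
      simpa using norm_sub_le (b + w) w
    nlinarith [norm_nonneg (b + w)]
  rw [← div_eq_mul_inv, div_div, div_le_div_iff₀ (by positivity) (by positivity)]
  nlinarith [mul_le_mul_of_nonneg_left h4 (by positivity : 0 ≤ R * (1 + ‖y‖ ^ 2))]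

theorem integral_char_smul_fourier_slice (hN : Module.finrank ℝ E < N)
    (hg : ContinuousOn (Function.uncurry g) {p | 0 < p.2})
    (hb : ∀ x t, 0 < t → ‖g x t‖ ≤ C * (t / (1 + ‖x‖)) ^ N) (η : E) {R : ℝ} (hR : 0 < R) :
    ∫ y : E, 𝐞 (R / (1 + ‖y‖ ^ 2) * inner ℝ y η) •
        𝓕 (fun x => g x (R / (1 + ‖y‖ ^ 2))) η =
      ∫ b : E, 𝐞 (-inner ℝ b η) •
        ∫ y : E, g (b + (R / (1 + ‖y‖ ^ 2)) • y) (R / (1 + ‖y‖ ^ 2)) := by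
  have hswap := integral_integral_swap
    (f := fun b y : E => 𝐞 (-inner ℝ b η) •
      g (b + (R / (1 + ‖y‖ ^ 2)) • y) (R / (1 + ‖y‖ ^ 2)))
    (integrable_horosphere_family hN hg hb η hR)
  have h1 : ∀ b : E, 𝐞 (-inner ℝ b η) •
        ∫ y : E, g (b + (R / (1 + ‖y‖ ^ 2)) • y) (R / (1 + ‖y‖ ^ 2)) =
      ∫ y : E, 𝐞 (-inner ℝ b η) •
        g (b + (R / (1 + ‖y‖ ^ 2)) • y) (R / (1 + ‖y‖ ^ 2)) := fun b => by
    simp only [Circle.smul_def]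
    exact (integral_smul _ _).symm
  simp only [h1]
  rw [hswap]
  congr 1
  ext y
  rw [Real.fourier_eq]
  set t := R / (1 + ‖y‖ ^ 2)
  -- Translating by `t y` matches the shift of the sphere and releases a phase that cancels the one
  -- on the left.
  rw [← integral_add_right_eq_self (fun x : E => 𝐞 (-inner ℝ x η) • g x t) (t • y)]
  have h2 : ∀ x : E, 𝐞 (-inner ℝ (x + t • y) η) • g (x + t • y) t =
      𝐞 (-(t * inner ℝ y η)) • 𝐞 (-inner ℝ x η) • g (x + t • y) t := by
    intro x
    rw [smul_smul, ← AddChar.map_add_eq_mul, inner_add_left, real_inner_smul_left, neg_add_rev]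
  simp only [h2]
  have h3 : ∫ x : E, 𝐞 (-(t * inner ℝ y η)) • 𝐞 (-inner ℝ x η) • g (x + t • y) t =
      𝐞 (-(t * inner ℝ y η)) • ∫ x : E, 𝐞 (-inner ℝ x η) • g (x + t • y) t := by
    simp only [Circle.smul_def (𝐞 (-(t * inner ℝ y η)))]
    exact integral_smul _ _
  rw [h3, smul_smul, ← AddChar.map_add_eq_mul, add_neg_cancel, AddChar.map_zero_eq_one, one_smul]

/-- The height is even in `y`, so averaging over `y` and `-y` replaces the character by a cosine.
The factor `2π` comes from the normalization of `𝐞`. -/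
theorem integral_cos_smul_eq_zero (η : E) {φ : ℝ → ℂ} {R : ℝ}
    (hi : Integrable fun y : E => φ (R / (1 + ‖y‖ ^ 2)))
    (h : ∫ y : E, 𝐞 (R / (1 + ‖y‖ ^ 2) * inner ℝ y η) • φ (R / (1 + ‖y‖ ^ 2)) = 0) :
    ∫ y : E, Real.cos (R / (1 + ‖y‖ ^ 2) * inner ℝ y ((2 * Real.pi) • η)) •
      φ (R / (1 + ‖y‖ ^ 2)) = 0 := by
  have hcont : Continuous fun y : E => R / (1 + ‖y‖ ^ 2) := continuous_horosphere_height
  have hneg : ∫ y : E, 𝐞 (-(R / (1 + ‖y‖ ^ 2) * inner ℝ y η)) • φ (R / (1 + ‖y‖ ^ 2)) = 0 := by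
    rw [← h, ← integral_neg_eq_self]
    simp only [norm_neg, inner_neg_left, mul_neg, neg_neg]
  have hint : ∀ ψ : E → ℝ, Continuous ψ →
      Integrable fun y : E => 𝐞 (ψ y) • φ (R / (1 + ‖y‖ ^ 2)) := by
    intro ψ hψ
    refine hi.mono ?_ (Eventually.of_forall fun y => by rw [Circle.norm_smul])
    exact (Real.continuous_fourierChar.comp hψ).aestronglyMeasurable.smul hi.1
  have hc : Continuous fun y : E => R / (1 + ‖y‖ ^ 2) * inner ℝ y η := by fun_prop
  have hsum := integral_add (hint _ hc)
    (hint (fun y => -(R / (1 + ‖y‖ ^ 2) * inner ℝ y η)) hc.neg)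
  rw [h, hneg, add_zero] at hsum
  have hpt : ∀ y : E, Real.cos (R / (1 + ‖y‖ ^ 2) * inner ℝ y ((2 * Real.pi) • η)) •
      φ (R / (1 + ‖y‖ ^ 2)) = (2⁻¹ : ℂ) • (𝐞 (R / (1 + ‖y‖ ^ 2) * inner ℝ y η) •
        φ (R / (1 + ‖y‖ ^ 2)) + 𝐞 (-(R / (1 + ‖y‖ ^ 2) * inner ℝ y η)) •
          φ (R / (1 + ‖y‖ ^ 2))) := by
    intro y
    rw [Circle.smul_def, Circle.smul_def, Real.fourierChar_apply, Real.fourierChar_apply,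
      ← add_smul, smul_smul, real_inner_smul_right, Complex.real_smul, smul_eq_mul,
      Complex.ofReal_cos, Complex.cos]
    push_cast
    ring_nf
  simp only [hpt]
  rw [integral_smul, hsum, smul_zero]

/-- The Volterra argument needs a function continuous on all of `ℝ`. Decay of order `N > a` absorbs
the singular power at `0`; the cutoff is needed because real powers of negative numbers are not zero
by convention. -/
theorem continuous_rpow_smul_of_norm_le {φ : ℝ → ℂ} (hφ : ContinuousOn φ (Ioi 0)) {C a : ℝ} {N : ℕ}
    (hN : a < N) (hb : ∀ t, 0 < t → ‖φ t‖ ≤ C * t ^ N) :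
    Continuous fun t : ℝ => (if 0 < t then t ^ (-a) else 0) • φ t := by
  rw [continuous_iff_continuousAt]
  intro t₀
  rcases lt_trichotomy t₀ 0 with h | rfl | h
  · refine (continuousAt_const (y := (0 : ℂ))).congr ?_
    filter_upwards [gt_mem_nhds h] with t ht
    rw [if_neg (not_lt.2 ht.le), zero_smul]
  · have h0 : (if (0 : ℝ) < 0 then (0 : ℝ) ^ (-a) else 0) • φ 0 = 0 := by simp
    rw [ContinuousAt, h0]
    have hlim : Tendsto (fun t : ℝ => |C| * |t| ^ ((N : ℝ) - a)) (𝓝 0) (𝓝 0) := by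
      have : ContinuousAt (fun t : ℝ => |C| * |t| ^ ((N : ℝ) - a)) 0 :=
        continuousAt_const.mul
          ((continuous_abs.continuousAt).rpow_const (Or.inr (sub_pos.2 hN).le))
      have h2 := this.tendsto
      simpa [Real.zero_rpow (sub_pos.2 hN).ne'] using h2
    refine squeeze_zero_norm (fun t => ?_) hlim
    by_cases ht : 0 < t
    · rw [if_pos ht, norm_smul, Real.norm_of_nonneg (Real.rpow_nonneg ht.le _), abs_of_pos ht]
      calc t ^ (-a) * ‖φ t‖ ≤ t ^ (-a) * (|C| * t ^ N) := by
            gcongr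
            exact (hb t ht).trans (by gcongr; exact le_abs_self C)
        _ = |C| * t ^ ((N : ℝ) - a) := by
            rw [sub_eq_neg_add, Real.rpow_add ht, Real.rpow_natCast]
            ring
    · rw [if_neg ht, zero_smul, norm_zero]
      positivity
  · have h1 : ContinuousAt (fun t : ℝ => t ^ (-a) • φ t) t₀ :=
      (Real.continuousAt_rpow_const _ _ (Or.inl h.ne')).smul
        (hφ.continuousAt (Ioi_mem_nhds h))
    refine h1.congr ?_
    filter_upwards [lt_mem_nhds h] with t ht
    rw [if_pos ht]

/-- Uniqueness for the horocycle transform over the spheres tangent to the boundary that lie below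
the plane at height `c`, except those tangent at one point. -/
theorem eq_zero_of_horosphere_integrals_eq_zero [Nontrivial E]
    (hN : Module.finrank ℝ E + 1 < N)
    (hg : ContinuousOn (Function.uncurry g) {p | 0 < p.2})
    (hb : ∀ x t, 0 < t → ‖g x t‖ ≤ C * (t / (1 + ‖x‖)) ^ N) {c : ℝ}
    (hv : ∀ b : E, b ≠ 0 → ∀ R ∈ Ioo 0 c,
      ∫ y : E, g (b + (R / (1 + ‖y‖ ^ 2)) • y) (R / (1 + ‖y‖ ^ 2)) = 0) :
    ∀ x, ∀ t ∈ Ioo 0 c, g x t = 0 := by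
  have hN' : Module.finrank ℝ E < N := by omega
  have hC : 0 ≤ C := by simpa using (norm_nonneg _).trans (hb 0 1 one_pos)
  have hd : 0 < Module.finrank ℝ E := Module.finrank_pos
  have hdN : (Module.finrank ℝ E : ℝ) / 2 + 1 < N := by
    have h1 : (Module.finrank ℝ E : ℝ) + 1 < N := by exact_mod_cast hN
    have h2 : (0 : ℝ) ≤ Module.finrank ℝ E := by positivity
    linarith
  have hfourier : ∀ η : E, ∀ t ∈ Ioo 0 c, 𝓕 (fun x => g x t) η = 0 := by
    intro η
    set φ : ℝ → ℂ := fun t => 𝓕 (fun x => g x t) η with hφ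
    set D : ℝ := C * ∫ x : E, ((1 + ‖x‖) ^ N)⁻¹ with hD
    have hD0 : 0 ≤ D := mul_nonneg hC (integral_nonneg fun x => by positivity)
    have hφc : ContinuousOn φ (Ioi 0) := continuousOn_fourier_slice hN' hg hb η
    have hφb : ∀ t, 0 < t → ‖φ t‖ ≤ D * t ^ N := fun t ht => norm_fourier_slice_le hN' hb η ht
    set ζ : E := (2 * Real.pi) • η with hζ
    set u : ℝ → ℂ := fun t =>
      (if 0 < t then t ^ (-((Module.finrank ℝ E : ℝ) / 2 + 1)) else 0) • φ t with hu
    have huc : Continuous u := continuous_rpow_smul_of_norm_le hφc hdN hφb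
    have hu0 : ∀ t ∈ Ioo 0 c, u t = 0 := by
      refine eqOn_zero_of_abel_volterra hd (sq_nonneg ‖ζ‖) (abs_sphereCosCoeff_le volume ζ)
        (sphereCosCoeff_zero_ne_zero volume ζ) huc fun R hR => ?_
      have hφb' : ∀ t, 0 < t → t ≤ R → ‖φ t‖ ≤
          D * R ^ (N - Module.finrank ℝ E) * t ^ Module.finrank ℝ E := by
        intro t ht htR
        calc ‖φ t‖ ≤ D * t ^ N := hφb t ht
          _ = D * (t ^ (N - Module.finrank ℝ E) * t ^ Module.finrank ℝ E) := by
            rw [← pow_add, Nat.sub_add_cancel hN'.le]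
          _ ≤ D * (R ^ (N - Module.finrank ℝ E) * t ^ Module.finrank ℝ E) := by gcongr
          _ = _ := (mul_assoc _ _ _).symm
      have hzero : ∫ y : E, 𝐞 (R / (1 + ‖y‖ ^ 2) * inner ℝ y η) • φ (R / (1 + ‖y‖ ^ 2)) = 0 := by
        rw [hφ]
        simp only
        rw [integral_char_smul_fourier_slice hN' hg hb η hR.1]
        refine integral_eq_zero_of_ae ?_
        -- The excluded point of tangency has measure zero, as `E` is nontrivial.
        filter_upwards [(measure_singleton (μ := volume) (0 : E) : volume {(0 : E)} = 0)
          |> compl_mem_ae_iff.2] with b hb0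
        rw [hv b hb0 R hR, smul_zero]
        rfl
      -- At frequency `0` the cosine is `1`, which leaves the integrability of `φ` along the sphere.
      have hi := integrable_cos_smul_horosphere_height volume hφc hφb' hR.1 (0 : E)
      simp only [inner_zero_right, mul_zero, Real.cos_zero, one_smul] at hi
      have hcos := integral_cos_smul_eq_zero η hi hzero
      have hrad := integral_cos_smul_horosphere_height volume hφc hφb' hR.1 ζ
      rw [hcos, smul_zero] at hrad
      rw [← hrad]
      refine setIntegral_congr_fun measurableSet_Ioo fun t ht => ?_
      simp only [hu, if_pos ht.1, neg_add']
    intro t ht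
    have h1 := hu0 t ht
    rw [hu] at h1
    simp only [if_pos ht.1] at h1
    exact (smul_eq_zero.1 h1).resolve_left (Real.rpow_pos_of_pos ht.1 _).ne'
  intro x t ht
  have hF : 𝓕 (fun x => g x t) = 0 := funext fun η => hfourier η t ht
  -- Inversion requires an integrable transform, which is clear here because the transform is zero.
  have h1 := (continuous_slice hg ht.1).fourierInv_fourier_eq
    (integrable_slice hN' hg hb ht.1) (by rw [hF]; exact integrable_zero _ _ _)
  rw [hF] at h1
  have h2 := congrFun h1 x
  rw [← h2, Real.fourierInv_eq]
  simp
end Core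

/-! ### Lower bounds for the hyperbolic distance -/

section HypDist
variable {n : ℕ}

theorem sqrt_hypMetric_self {x : CoordSpace n} (hx : 0 < x.2) (v : CoordSpace n) :
    √(hypMetric x v v) = √(‖v.1‖ ^ 2 + v.2 ^ 2) / x.2 := by
  rw [hypMetric, real_inner_self_eq_norm_sq, ← sq, Real.sqrt_div' _ (sq_nonneg _),
    Real.sqrt_sq hx.le]

theorem hypDist_nonneg (x y : HalfSpace n) : 0 ≤ hypDist x y := by
  refine Real.sInf_nonneg ?_
  rintro L ⟨γ, -, -, -, -, rfl⟩
  exact intervalIntegral.integral_nonneg zero_le_one fun t _ => Real.sqrt_nonneg _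

/-- The infimum of the empty set of reals is `0`, so a lower bound for the distance needs a
competing curve; a segment stays in the half space. -/
theorem exists_curve (x y : HalfSpace n) : ∃ γ : ℝ → CoordSpace n, ContDiff ℝ 1 γ ∧
    (∀ t ∈ Icc (0 : ℝ) 1, 0 < (γ t).2) ∧ γ 0 = x.1 ∧ γ 1 = y.1 := by
  refine ⟨fun t => (1 - t) • x.1 + t • y.1, by fun_prop, fun t ht => ?_, by simp, by simp⟩
  have hx := x.2
  have hy := y.2
  simp only [Prod.snd_add, Prod.smul_snd, smul_eq_mul]
  rcases ht.1.eq_or_lt with h | h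
  · rw [← h]; simpa
  · nlinarith [mul_nonneg (sub_nonneg.2 ht.2) hx.le, mul_pos h hy]

/-- A function that is `K`-Lipschitz for the hyperbolic metric, in the infinitesimal sense,
increases by at most `K` times the distance. -/
theorem sub_le_mul_hypDist {Φ : CoordSpace n → ℝ} {Φ' : CoordSpace n → CoordSpace n →L[ℝ] ℝ}
    {K : ℝ} (hK : 0 < K) (hΦ : ∀ x : CoordSpace n, 0 < x.2 → HasFDerivAt Φ (Φ' x) x)
    (hb : ∀ x v : CoordSpace n, 0 < x.2 → Φ' x v ≤ K * √(hypMetric x v v)) (x y : HalfSpace n) :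
    Φ y.1 - Φ x.1 ≤ K * hypDist x y := by
  rw [mul_comm, ← div_le_iff₀ hK]
  refine le_csInf ?_ ?_
  · obtain ⟨γ, h1, h2, h3, h4⟩ := exists_curve x y
    exact ⟨_, γ, h1, h2, h3, h4, rfl⟩
  rintro L ⟨γ, hγ, hpos, h0, h1, rfl⟩
  rw [div_le_iff₀ hK, mul_comm, hypLength, ← intervalIntegral.integral_const_mul, ← h0, ← h1]
  have hd : ∀ t, HasDerivAt γ (deriv γ t) t := fun t =>
    (hγ.differentiable one_ne_zero t).hasDerivAt
  have hγ' : Continuous (deriv γ) := hγ.continuous_deriv le_rfl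
  have hcomp : ∀ t ∈ Icc (0 : ℝ) 1, HasDerivAt (Φ ∘ γ) (Φ' (γ t) (deriv γ t)) t := fun t ht =>
    (hΦ _ (hpos t ht)).comp_hasDerivAt t (hd t)
  refine intervalIntegral.sub_le_integral_of_hasDeriv_right_of_le (g := Φ ∘ γ) zero_le_one
    (fun t ht => (hcomp t ht).continuousAt.continuousWithinAt)
    (fun t ht => (hcomp t (Ioo_subset_Icc_self ht)).hasDerivWithinAt) ?_
    (fun t ht => hb _ _ (hpos t (Ioo_subset_Icc_self ht)))
  refine ContinuousOn.integrableOn_Icc ?_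
  simp only [hypMetric]
  have hc := hγ.continuous
  refine continuousOn_const.mul (ContinuousOn.sqrt (ContinuousOn.div ?_ ?_ fun t ht => ?_))
  · exact Continuous.continuousOn (by fun_prop)
  · exact Continuous.continuousOn (by fun_prop)
  · exact pow_ne_zero 2 (hpos t ht).ne'

/-- The function `-log xₙ` is 1-Lipschitz for the hyperbolic metric and vanishes at the origin. -/
theorem inv_height_le_exp_hypDist (x : HalfSpace n) :
    x.1.2⁻¹ ≤ Real.exp (hypDist (hypOrigin n) x) := by
  have h := sub_le_mul_hypDist (n := n) (Φ := fun x => -Real.log x.2)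
    (Φ' := fun x => -(x.2⁻¹ • ContinuousLinearMap.snd ℝ _ _)) one_pos
    (fun x hx => (hasFDerivAt_snd.log hx.ne').neg)
    (fun x v hx => by
      rw [sqrt_hypMetric_self hx, one_mul]
      have h1 : -v.2 ≤ √(‖v.1‖ ^ 2 + v.2 ^ 2) :=
        Real.le_sqrt_of_sq_le (by nlinarith [sq_nonneg ‖v.1‖])
      calc _ = -v.2 / x.2 := by simp; ring
        _ ≤ _ := by gcongr) (hypOrigin n) x
  simp only [hypOrigin, Real.log_one, neg_zero, sub_zero, one_mul] at h
  rw [← Real.log_le_iff_le_exp (inv_pos.2 x.2), Real.log_inv]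
  exact h

/-- The logarithm of the left side is 2-Lipschitz: by Cauchy–Schwarz its Euclidean gradient has norm
at most `2 / √q`, where `q` is the left side, and `√q ≥ xₙ`. -/
theorem norm_sq_add_sq_le_exp_hypDist (x : HalfSpace n) :
    ‖x.1.1‖ ^ 2 + (x.1.2 + 1) ^ 2 ≤ 4 * Real.exp (hypDist (hypOrigin n) x) ^ 2 := by
  have hq : ∀ x : CoordSpace n, 0 < x.2 → 0 < ‖x.1‖ ^ 2 + (x.2 + 1) ^ 2 := fun x hx => by
    positivity
  have h := sub_le_mul_hypDist (n := n) (Φ := fun x => Real.log (‖x.1‖ ^ 2 + (x.2 + 1) ^ 2))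
    (Φ' := fun x => (‖x.1‖ ^ 2 + (x.2 + 1) ^ 2)⁻¹ •
      ((2 • innerSL ℝ x.1).comp (ContinuousLinearMap.fst ℝ _ _) +
        (2 * (x.2 + 1)) • ContinuousLinearMap.snd ℝ _ _)) two_pos
    (fun x hx => by
      refine HasFDerivAt.log ?_ (hq x hx).ne'
      refine HasFDerivAt.add ?_ ?_
      · exact (hasStrictFDerivAt_norm_sq x.1).hasFDerivAt.comp x hasFDerivAt_fst
      · have h1 : HasFDerivAt (fun x : CoordSpace n => x.2 + 1)
          (ContinuousLinearMap.snd ℝ _ _) x := hasFDerivAt_snd.add_const 1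
        refine ((hasDerivAt_pow 2 (x.2 + 1)).comp_hasFDerivAt x h1).congr_fderiv ?_
        norm_num)
    (fun x v hx => by
      rw [sqrt_hypMetric_self hx]
      set q := ‖x.1‖ ^ 2 + (x.2 + 1) ^ 2 with hqdef
      have hq0 : 0 < q := hq x hx
      set w := √(‖v.1‖ ^ 2 + v.2 ^ 2) with hw
      have hw0 : 0 ≤ w := Real.sqrt_nonneg _
      have hw2 : w ^ 2 = ‖v.1‖ ^ 2 + v.2 ^ 2 := Real.sq_sqrt (by positivity)
      have h1 : inner ℝ x.1 v.1 + (x.2 + 1) * v.2 ≤ √q * w := by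
        have h2 : inner ℝ x.1 v.1 ≤ ‖x.1‖ * ‖v.1‖ := real_inner_le_norm _ _
        refine le_trans (add_le_add_left h2 _) ?_
        rw [hw, ← Real.sqrt_mul hq0.le]
        refine Real.le_sqrt_of_sq_le ?_
        nlinarith [sq_nonneg (‖x.1‖ * v.2 - (x.2 + 1) * ‖v.1‖)]
      have h3 : x.2 ≤ √q := Real.le_sqrt_of_sq_le (by nlinarith [sq_nonneg ‖x.1‖])
      have h4 : √q * √q = q := Real.mul_self_sqrt hq0.le
      have h5 : 0 < √q := Real.sqrt_pos.2 hq0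
      calc _ = 2 * ((inner ℝ x.1 v.1 + (x.2 + 1) * v.2) / q) := by simp; ring
        _ ≤ 2 * (√q * w / q) := by gcongr
        _ = 2 * (w / √q) := by
          congr 1
          rw [div_eq_div_iff hq0.ne' h5.ne']
          linear_combination w * h4
        _ ≤ 2 * (w / x.2) := by gcongr) (hypOrigin n) x
  simp only [hypOrigin, norm_zero] at h
  have h0 : Real.log (0 ^ 2 + (1 + 1) ^ 2) = Real.log 4 := by norm_num
  rw [h0, ← Real.log_div (hq x.1 x.2).ne' (by norm_num),
    Real.log_le_iff_le_exp (div_pos (hq x.1 x.2) (by norm_num)), div_le_iff₀ (by norm_num)] at h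
  refine h.trans_eq ?_
  rw [← Real.exp_nat_mul, mul_comm]
  norm_num [hypOrigin]

end HypDist

/-! ### The transform in stereographic coordinates -/

section Transform
variable {n : ℕ}

theorem fderiv_param_sphere (a : EuclideanSpace ℝ (Fin (n - 1))) (r : ℝ) (hr : 0 < r)
    (y v : EuclideanSpace ℝ (Fin (n - 1))) :
    fderiv ℝ (fun z => ((Horocycle.sphere a r hr).param z).1) y v =
      ((2 * r / (1 + ‖y‖ ^ 2)) • v -
          (2 * r / (1 + ‖y‖ ^ 2) * (2 * inner ℝ y v / (1 + ‖y‖ ^ 2))) • y,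
        -(2 * r / (1 + ‖y‖ ^ 2) * (2 * inner ℝ y v / (1 + ‖y‖ ^ 2)))) := by
  have hq : HasFDerivAt (fun z : EuclideanSpace ℝ (Fin (n - 1)) => 1 + ‖z‖ ^ 2)
      (2 • innerSL ℝ y) y := (hasStrictFDerivAt_norm_sq y).hasFDerivAt.const_add 1
  have hq0 : 1 + ‖y‖ ^ 2 ≠ 0 := by positivity
  have hρ : HasFDerivAt (fun z : EuclideanSpace ℝ (Fin (n - 1)) => 2 * r / (1 + ‖z‖ ^ 2))
      ((2 * r) • (-((1 + ‖y‖ ^ 2) ^ 2)⁻¹) • (2 • innerSL ℝ y)) y := by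
    simp only [div_eq_mul_inv]
    exact ((hasDerivAt_inv hq0).comp_hasFDerivAt y hq).const_mul (2 * r)
  have h : HasFDerivAt (fun z => ((Horocycle.sphere a r hr).param z).1) _ y :=
    ((hρ.smul (hasFDerivAt_id y)).const_add a).prodMk hρ
  have hcoef : 2 * r * (((1 + ‖y‖ ^ 2) ^ 2)⁻¹ * (2 * inner ℝ y v)) =
      2 * r / (1 + ‖y‖ ^ 2) * (2 * inner ℝ y v / (1 + ‖y‖ ^ 2)) := by
    field_simp
  rw [h.fderiv, ← hcoef]
  ext1 <;> simp [sub_eq_add_neg]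

/-- Horospheres are flat: the stereographic chart pulls the hyperbolic metric back to the Euclidean
one. -/
theorem volumeDensity_sphere (a : EuclideanSpace ℝ (Fin (n - 1))) (r : ℝ) (hr : 0 < r)
    (y : EuclideanSpace ℝ (Fin (n - 1))) : (Horocycle.sphere a r hr).volumeDensity y = 1 := by
  have hm : ∀ v w : EuclideanSpace ℝ (Fin (n - 1)),
      hypMetric ((Horocycle.sphere a r hr).param y).1
        (fderiv ℝ (fun z => ((Horocycle.sphere a r hr).param z).1) y v)
        (fderiv ℝ (fun z => ((Horocycle.sphere a r hr).param z).1) y w) = inner ℝ v w := by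
    intro v w
    rw [fderiv_param_sphere, fderiv_param_sphere, hypMetric]
    simp only [Horocycle.param]
    rw [inner_sub_left, inner_sub_right, inner_sub_right]
    simp only [real_inner_smul_left, real_inner_smul_right, real_inner_self_eq_norm_sq,
      real_inner_comm y v]
    have hq0 : 1 + ‖y‖ ^ 2 ≠ 0 := by positivity
    field_simp
    ring
  rw [Horocycle.volumeDensity]
  simp only [hm]
  have h1 : (Matrix.of fun i j : Fin (n - 1) =>
      inner ℝ (EuclideanSpace.single i (1 : ℝ)) (EuclideanSpace.single j (1 : ℝ))) = 1 := by
    ext i j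
    simp [Matrix.one_apply, EuclideanSpace.inner_single_left]
  rw [h1, Matrix.det_one, Real.sqrt_one]

theorem horocycleTransform_sphere (f : HalfSpace n → ℂ) (a : EuclideanSpace ℝ (Fin (n - 1)))
    (r : ℝ) (hr : 0 < r) : horocycleTransform f (.sphere a r hr) =
      ∫ y, f ((Horocycle.sphere a r hr).param y) := by
  simp only [horocycleTransform, volumeDensity_sphere, Complex.ofReal_one, one_mul]

/-- Uniqueness for the pullback of an exponentially decreasing function by a map that distorts
`exp d(o, ·)` at most polynomially. -/
theorem comp_eq_zero_of_integral_param_eq_zero (hn : 2 ≤ n) {f : HalfSpace n → ℂ}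
    (hf : Continuous f) (hdec : ExponentiallyDecreasing f) {Ψ : HalfSpace n → HalfSpace n}
    (hΨ : Continuous Ψ) {A : ℝ} {k : ℕ} (hk : 0 < k)
    (h1 : ∀ p : HalfSpace n, p.1.2⁻¹ ≤ A * Real.exp (hypDist (hypOrigin n) (Ψ p)) ^ k)
    (h2 : ∀ p : HalfSpace n, 1 + ‖p.1.1‖ ≤ A * Real.exp (hypDist (hypOrigin n) (Ψ p)) ^ k)
    {c : ℝ} (hv : ∀ b : EuclideanSpace ℝ (Fin (n - 1)), b ≠ 0 → ∀ r, ∀ hr : 0 < r, 2 * r < c →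
      ∫ y, f (Ψ ((Horocycle.sphere b r hr).param y)) = 0)
    (p : HalfSpace n) (hp : p.1.2 < c) : f (Ψ p) = 0 := by
  have : Nonempty (Fin (n - 1)) := ⟨⟨0, by omega⟩⟩
  set g : EuclideanSpace ℝ (Fin (n - 1)) → ℝ → ℂ := fun x t =>
    if h : 0 < t then f (Ψ ⟨(x, t), h⟩) else 0 with hgdef
  have hg : ∀ x t, ∀ h : 0 < t, g x t = f (Ψ ⟨(x, t), h⟩) := fun x t h => dif_pos h
  have hgc : ContinuousOn (Function.uncurry g) {p | 0 < p.2} := by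
    rw [continuousOn_iff_continuous_domRestrict]
    have : ({p | 0 < p.2} : Set (CoordSpace n)).domRestrict (Function.uncurry g) = f ∘ Ψ :=
      funext fun p => hg _ _ p.2
    rw [this]
    exact hf.comp hΨ
  set N := Module.finrank ℝ (EuclideanSpace ℝ (Fin (n - 1))) + 2 with hN
  -- Both `t⁻¹` and `1 + ‖x‖` are at most `A Wᵏ`, so `N` powers of their product cost `W ^ (2 k N)`.
  obtain ⟨C, hC⟩ := hdec (2 * k * N : ℕ) (by positivity)
  have hbound : ∀ p : HalfSpace n,
      ‖f (Ψ p)‖ ≤ C * A ^ (2 * N) * (p.1.2 / (1 + ‖p.1.1‖)) ^ N := by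
    intro p
    have hC1 := hC ⟨Ψ p, rfl⟩
    simp only at hC1
    rw [Real.exp_nat_mul] at hC1
    set W := Real.exp (hypDist (hypOrigin n) (Ψ p)) with hW
    have hW0 : 0 < W := Real.exp_pos _
    have hC0 : 0 ≤ C := le_trans (by positivity) hC1
    have hp := p.2
    have h3 : (1 + ‖p.1.1‖) / p.1.2 ≤ A ^ 2 * W ^ (2 * k) := by
      calc (1 + ‖p.1.1‖) / p.1.2 = (1 + ‖p.1.1‖) * p.1.2⁻¹ := div_eq_mul_inv _ _
        _ ≤ (A * W ^ k) * (A * W ^ k) := by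
          have := h1 p
          have := h2 p
          have h4 : (0 : ℝ) ≤ 1 + ‖p.1.1‖ := by positivity
          gcongr
          linarith
        _ = _ := by ring
    have h5 : 1 ≤ (A ^ 2 * W ^ (2 * k)) ^ N * (p.1.2 / (1 + ‖p.1.1‖)) ^ N := by
      rw [← mul_pow]
      refine one_le_pow₀ ?_
      rw [← div_le_iff₀ (by positivity), one_div_div]
      exact h3
    calc ‖f (Ψ p)‖ = ‖f (Ψ p)‖ * 1 := (mul_one _).symm
      _ ≤ ‖f (Ψ p)‖ * ((A ^ 2 * W ^ (2 * k)) ^ N * (p.1.2 / (1 + ‖p.1.1‖)) ^ N) := by gcongr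
      _ = (‖f (Ψ p)‖ * W ^ (2 * k * N)) * (A ^ (2 * N) * (p.1.2 / (1 + ‖p.1.1‖)) ^ N) := by
        rw [mul_pow, ← pow_mul, ← pow_mul]; ring
      _ ≤ C * (A ^ (2 * N) * (p.1.2 / (1 + ‖p.1.1‖)) ^ N) := by
        have : 0 ≤ A ^ (2 * N) := by rw [pow_mul]; positivity
        gcongr
      _ = _ := by ring
  have key := eq_zero_of_horosphere_integrals_eq_zero (g := g) (C := C * A ^ (2 * N)) (N := N)
    (by omega) hgc (fun x t ht => by rw [hg x t ht]; exact hbound ⟨(x, t), ht⟩) (c := c)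
    (fun b hb R hR => by
      have h := hv b hb (R / 2) (half_pos hR.1) (by linarith [hR.2])
      rw [← h]
      congr 1
      ext y
      have hpos : 0 < R / (1 + ‖y‖ ^ 2) := div_pos hR.1 (by positivity)
      rw [hg _ _ hpos]
      simp only [Horocycle.param, mul_div_cancel₀ R (two_ne_zero' ℝ)])
    p.1.1 p.1.2 ⟨p.2, hp⟩
  rwa [hg _ _ p.2] at key

end Transform

theorem integral_comp_isometry_sub {E : Type*} [NormedAddCommGroup E] [InnerProductSpace ℝ E]
    [FiniteDimensional ℝ E] [MeasurableSpace E] [BorelSpace E] (L : E ≃ₗᵢ[ℝ] E) (v : E)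
    (F : E → ℂ) : ∫ y, F (L y - v) = ∫ y, F y := by
  rw [L.measurePreserving.integral_comp L.toHomeomorph.measurableEmbedding fun z => F (z - v)]
  exact integral_sub_right_eq_self F v

/-! ### Reduction of a sphere to a plane by inversion -/

section Inversion
variable {n : ℕ}

theorem inversion_denom_pos (p : HalfSpace n) : 0 < ‖p.1.1‖ ^ 2 + p.1.2 ^ 2 := by
  have := p.2
  positivity

/-- The inversion in the unit sphere about the origin, followed by the translation by `a`: an
isometry of `Hⁿ`. -/
def inversionTranslate (a : EuclideanSpace ℝ (Fin (n - 1))) (p : HalfSpace n) : HalfSpace n :=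
  ⟨(a + (‖p.1.1‖ ^ 2 + p.1.2 ^ 2)⁻¹ • p.1.1, p.1.2 / (‖p.1.1‖ ^ 2 + p.1.2 ^ 2)),
    div_pos p.2 (inversion_denom_pos p)⟩

theorem continuous_inversionTranslate (a : EuclideanSpace ℝ (Fin (n - 1))) :
    Continuous (inversionTranslate a) := by
  refine Continuous.subtype_mk (Continuous.prodMk ?_ ?_) _
  · exact continuous_const.add
      ((Continuous.inv₀ (by fun_prop) fun p => (inversion_denom_pos p).ne').smul (by fun_prop))
  · exact Continuous.div (by fun_prop) (by fun_prop) fun p => (inversion_denom_pos p).ne'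

theorem hypOrigin_exp_bounds (x : HalfSpace n) :
    1 ≤ Real.exp (hypDist (hypOrigin n) x) ∧
    1 ≤ Real.exp (hypDist (hypOrigin n) x) * x.1.2 ∧
    ‖x.1.1‖ ≤ 2 * Real.exp (hypDist (hypOrigin n) x) ∧
    x.1.2 ≤ 2 * Real.exp (hypDist (hypOrigin n) x) := by
  have h1 := inv_height_le_exp_hypDist x
  have h2 := norm_sq_add_sq_le_exp_hypDist x
  have h3 := Real.one_le_exp (hypDist_nonneg (hypOrigin n) x)
  have hx := x.2
  refine ⟨h3, ?_, ?_, ?_⟩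
  · rw [inv_eq_one_div, div_le_iff₀ hx] at h1
    exact h1
  · exact abs_le_of_sq_le_sq' (by nlinarith) (by positivity) |>.2
  · exact abs_le_of_sq_le_sq' (by nlinarith [sq_nonneg ‖x.1.1‖]) (by positivity) |>.2

/-- The source is recovered from the image. With `Q = ‖x‖² + t²`, `Q⁻¹` is the squared norm of the
image translated back, so it is `O(W²)`; the image height `t / Q` is at least `W⁻¹`, so `t⁻¹ = (Q /
t) Q⁻¹` is `O(W³)`, and `‖x‖² + t² ≤ W t` gives `‖x‖ ≤ W`. -/
theorem inversionTranslate_bounds (a : EuclideanSpace ℝ (Fin (n - 1))) (p : HalfSpace n) :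
    p.1.2⁻¹ ≤ ((2 + ‖a‖) ^ 2 + 4) *
      Real.exp (hypDist (hypOrigin n) (inversionTranslate a p)) ^ 3 ∧
    1 + ‖p.1.1‖ ≤ ((2 + ‖a‖) ^ 2 + 4) *
      Real.exp (hypDist (hypOrigin n) (inversionTranslate a p)) ^ 3 := by
  obtain ⟨h1, h2, h3, h4⟩ := hypOrigin_exp_bounds (inversionTranslate a p)
  set W := Real.exp (hypDist (hypOrigin n) (inversionTranslate a p)) with hW
  have hQ := inversion_denom_pos p
  have hp := p.2
  simp only [inversionTranslate] at h2 h3 h4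
  set t := p.1.2 with ht
  set x := p.1.1 with hx
  set Q := ‖x‖ ^ 2 + t ^ 2 with hQd
  have hxQ : ‖x‖ / Q ≤ (2 + ‖a‖) * W := by
    have e : ‖Q⁻¹ • x‖ = ‖x‖ / Q := by
      rw [norm_smul, Real.norm_of_nonneg (inv_nonneg.2 hQ.le)]; ring
    rw [← e]
    have h5 : ‖Q⁻¹ • x‖ ≤ ‖a + Q⁻¹ • x‖ + ‖a‖ := by
      simpa using norm_sub_le (a + Q⁻¹ • x) a
    nlinarith [norm_nonneg a]
  have hinvQ : Q⁻¹ ≤ ((2 + ‖a‖) ^ 2 + 4) * W ^ 2 := by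
    have e : Q⁻¹ = (‖x‖ / Q) ^ 2 + (t / Q) ^ 2 := by
      rw [div_pow, div_pow, ← add_div, ← hQd]
      field_simp
    rw [e]
    calc _ ≤ ((2 + ‖a‖) * W) ^ 2 + (2 * W) ^ 2 := by gcongr
      _ = _ := by ring
  constructor
  · have e : t⁻¹ ≤ W * Q⁻¹ := by
      rw [mul_div_assoc', le_div_iff₀ hQ, one_mul] at h2
      rw [← div_eq_mul_inv, le_div_iff₀ hQ, ← div_eq_inv_mul, div_le_iff₀ hp]
      exact h2
    calc t⁻¹ ≤ W * Q⁻¹ := e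
      _ ≤ W * (((2 + ‖a‖) ^ 2 + 4) * W ^ 2) := by gcongr
      _ = _ := by ring
  · have e : Q ≤ W * t := by
      rwa [mul_div_assoc', le_div_iff₀ hQ, one_mul] at h2
    have h5 : ‖x‖ ≤ W := by
      refine abs_le_of_sq_le_sq' ?_ (by linarith) |>.2
      nlinarith [sq_nonneg (W - t)]
    have h6 : W ≤ W ^ 3 := le_self_pow₀ h1 (by norm_num)
    have h7 : 4 ≤ (2 + ‖a‖) ^ 2 + 4 := by nlinarith [sq_nonneg (2 + ‖a‖)]
    nlinarith [mul_le_mul_of_nonneg_right h7 (by positivity : 0 ≤ W ^ 3)]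

/-- Between the flat charts the inversion acts as a Euclidean isometry, a reflection in `bᗮ`
followed by a translation, so it preserves the integrals. For `b = 0` the image would be a plane. -/
theorem inversionTranslate_param_sphere (a b : EuclideanSpace ℝ (Fin (n - 1))) (hb : b ≠ 0) (s : ℝ)
    (hs : 0 < s) (hs' : 0 < s / ‖b‖ ^ 2) (y : EuclideanSpace ℝ (Fin (n - 1))) :
    inversionTranslate a ((Horocycle.sphere b s hs).param y) =
      (Horocycle.sphere (a + (‖b‖ ^ 2)⁻¹ • b) (s / ‖b‖ ^ 2) hs').param
        ((ℝ ∙ b)ᗮ.reflection y - (2 * s / ‖b‖ ^ 2) • b) := by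
  have hb2 : 0 < ‖b‖ ^ 2 := by positivity
  have hT : (ℝ ∙ b)ᗮ.reflection y - (2 * s / ‖b‖ ^ 2) • b =
      y - (2 * (inner ℝ b y + s) / ‖b‖ ^ 2) • b := by
    rw [Submodule.reflection_orthogonal_apply, Submodule.reflection_singleton_apply]
    simp only [Real.ringHom_apply]
    module
  rw [hT]
  set β := ‖b‖ ^ 2 with hβ
  set i := inner ℝ b y with hi
  set κ := 2 * (i + s) / β with hκ
  have hκβ : κ * β = 2 * (i + s) := by rw [hκ]; field_simp
  set t := 2 * s / (1 + ‖y‖ ^ 2) with ht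
  have hq : 0 < 1 + ‖y‖ ^ 2 := by positivity
  have htq : t * (1 + ‖y‖ ^ 2) = 2 * s := by rw [ht]; field_simp
  have ht0 : 0 < t := by positivity
  have hz : ‖y - κ • b‖ ^ 2 = ‖y‖ ^ 2 + 2 * κ * s := by
    rw [norm_sub_sq_real, real_inner_smul_right, norm_smul, mul_pow, Real.norm_eq_abs, sq_abs,
      real_inner_comm, ← hβ, ← hi]
    linear_combination κ * hκβ
  have hQ : ‖b + t • y‖ ^ 2 + t ^ 2 = β * (1 + t * κ) := by
    rw [norm_add_sq_real, real_inner_smul_right, norm_smul, mul_pow, Real.norm_eq_abs, sq_abs,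
      ← hβ, ← hi]
    linear_combination t * htq - t * hκβ
  have hQ0 : 0 < β * (1 + t * κ) := by rw [← hQ]; positivity
  have hp : 0 < 1 + t * κ := pos_of_mul_pos_right hQ0 hb2.le
  have hw : t * (1 + (‖y‖ ^ 2 + 2 * κ * s)) = 2 * s * (1 + t * κ) := by
    linear_combination htq
  have hw0 : 0 < 1 + (‖y‖ ^ 2 + 2 * κ * s) := by
    rw [← hz]; positivity
  have hheight : 2 * (s / β) / (1 + ‖y - κ • b‖ ^ 2) = t / (β * (1 + t * κ)) := by
    rw [hz, ← mul_div_assoc, div_div, div_eq_div_iff (by positivity) (by positivity)]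
    linear_combination -β * hw
  refine Subtype.ext (Prod.ext ?_ ?_)
  · simp only [inversionTranslate, Horocycle.param]
    rw [hheight, ← ht, hQ, add_assoc]
    congr 1
    have e1 : β⁻¹ = (β * (1 + t * κ))⁻¹ * (1 + t * κ) := by field_simp
    rw [e1]
    module
  · simp only [inversionTranslate, Horocycle.param]
    rw [hheight, ← ht, hQ]

/-- Inversion about `a` takes the sphere of radius `r` to height `1 / (2 r)` and the other sphere to
one of diameter `2 s`, which lies lower when `4 r s < 1`. -/
theorem inversionTranslate_image_subset {a b : EuclideanSpace ℝ (Fin (n - 1))} (hb : b ≠ 0)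
    {r s : ℝ} (hr : 0 < r) (hs' : 0 < s / ‖b‖ ^ 2) (hrs : 4 * r * s < 1) :
    (Horocycle.sphere (a + (‖b‖ ^ 2)⁻¹ • b) (s / ‖b‖ ^ 2) hs').carrier ⊆
      (Horocycle.sphere a r hr).exterior := by
  intro p hp
  have hb2 : 0 < ‖b‖ ^ 2 := by positivity
  have hp0 := p.2
  simp only [Horocycle.carrier, Horocycle.exterior, mem_ofPred_eq] at hp ⊢
  rw [← sub_sub] at hp
  set w := p.1.1 - a
  set t := p.1.2
  set Z := ‖w‖ ^ 2 + t ^ 2 with hZ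
  have hZ0 : 0 < Z := by positivity
  have h1 : ‖b‖ ^ 2 * Z = 2 * inner ℝ w b - 1 + 2 * t * s := by
    rw [norm_sub_sq_real, real_inner_smul_right, norm_smul, mul_pow, Real.norm_eq_abs, sq_abs] at hp
    field_simp at hp
    refine mul_left_cancel₀ hb2.ne' ?_
    rw [hZ]
    linear_combination hp
  -- Expanding `‖w - Z b‖² ≥ 0` and eliminating `‖b‖² Z` by `h1` gives `t ≤ 2 s Z`: the inverted
  -- height is at most the diameter `2 s`.
  have h2 : 0 ≤ ‖w‖ ^ 2 - 2 * (Z * inner ℝ w b) + Z ^ 2 * ‖b‖ ^ 2 := by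
    have := sq_nonneg ‖w - Z • b‖
    rwa [norm_sub_sq_real, real_inner_smul_right, norm_smul, mul_pow, Real.norm_eq_abs, sq_abs]
      at this
  have h3 : 0 ≤ t * (2 * s * Z - t) := by
    nlinarith
  have h4 : t ≤ 2 * s * Z := by
    by_contra hcon
    nlinarith [not_le.1 hcon]
  nlinarith

end Inversion

end

/-! ### The two types of fixed horocycle -/

theorem theorem2p2 (n : ℕ) (hn : 2 ≤ n) (ξ₀ : Horocycle n) (f : HalfSpace n → ℂ)
    (hf : Continuous f) (hdec : ExponentiallyDecreasing f)
    (hvanish : ∀ ξ : Horocycle n, ξ.carrier ⊆ ξ₀.exterior → horocycleTransform f ξ = 0) :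
    ∀ x ∈ ξ₀.exterior, f x = 0 := by
  intro x hx
  cases ξ₀ with
  | plane c hc =>
    -- The constant `3` absorbs `1 + 2 W` because `W ≥ 1`.
    refine comp_eq_zero_of_integral_param_eq_zero hn hf hdec continuous_id (Ψ := id) (A := 3)
      (k := 1) one_pos (fun p => ?_) (fun p => ?_) (c := c) (fun b _ r hr hrc => ?_) x hx
    · obtain ⟨h1, h2, -, -⟩ := hypOrigin_exp_bounds p
      have := inv_height_le_exp_hypDist p
      simp only [id, pow_one]
      linarith
    · obtain ⟨h1, -, h3, -⟩ := hypOrigin_exp_bounds p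
      simp only [id, pow_one]
      linarith
    · rw [← hvanish (.sphere b r hr), horocycleTransform_sphere]
      · rfl
      · intro p hp
        simp only [Horocycle.carrier, Horocycle.exterior, mem_ofPred_eq] at hp ⊢
        have hp0 := p.2
        nlinarith [sq_nonneg ‖p.1.1 - b‖]
  | sphere a r hr =>
    have hx0 := x.2
    simp only [Horocycle.exterior, mem_ofPred_eq] at hx
    have hZ0 : 0 < ‖x.1.1 - a‖ ^ 2 + x.1.2 ^ 2 := by positivity
    set Z := ‖x.1.1 - a‖ ^ 2 + x.1.2 ^ 2 with hZ
    have hp0 : 0 < x.1.2 / Z := div_pos hx0 hZ0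
    -- Inversion is an involution, so the preimage of `x` is the inverse of its translate by `-a`.
    set p : HalfSpace n := ⟨(Z⁻¹ • (x.1.1 - a), x.1.2 / Z), hp0⟩ with hpdef
    have hpx : inversionTranslate a p = x := by
      have hden : ‖Z⁻¹ • (x.1.1 - a)‖ ^ 2 + (x.1.2 / Z) ^ 2 = Z⁻¹ := by
        rw [norm_smul, mul_pow, Real.norm_eq_abs, sq_abs, div_pow, inv_pow,
          ← div_eq_inv_mul, ← add_div, ← hZ]
        field_simp
      refine Subtype.ext (Prod.ext ?_ ?_)
      · simp only [inversionTranslate, hpdef]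
        rw [hden, inv_inv, smul_smul, mul_inv_cancel₀ hZ0.ne', one_smul, add_sub_cancel]
      · simp only [inversionTranslate, hpdef]
        rw [hden]
        field_simp
    rw [← hpx]
    refine comp_eq_zero_of_integral_param_eq_zero hn hf hdec (continuous_inversionTranslate a)
      three_pos (fun p => (inversionTranslate_bounds a p).1)
      (fun p => (inversionTranslate_bounds a p).2) (c := 1 / (2 * r)) (fun b hb s hs hsc => ?_) p ?_
    · have hs' : 0 < s / ‖b‖ ^ 2 := by positivity
      have hrs : 4 * r * s < 1 := by
        rw [lt_div_iff₀ (by positivity)] at hsc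
        linarith
      have h := hvanish _ (inversionTranslate_image_subset (a := a) hb hr hs' hrs)
      rw [horocycleTransform_sphere] at h
      simp only [inversionTranslate_param_sphere a b hb s hs hs']
      rw [← h]
      exact integral_comp_isometry_sub (ℝ ∙ b)ᗮ.reflection ((2 * s / ‖b‖ ^ 2) • b) (fun z => f
          ((Horocycle.sphere (a + (‖b‖ ^ 2)⁻¹ • b) (s / ‖b‖ ^ 2) hs').param z))
    -- The exterior condition `Z > 2 r xₙ` says exactly that the height `xₙ / Z` of `p` is below `1
    -- / (2 r)`.
    · simp only [hpdef]
      rw [div_lt_div_iff₀ hZ0 (by positivity)]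
      linarith
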